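/- Let $R$ be a commutative domain containing $\mathbb{Q}$ and $\delta$ a derivation of $R$. Let $C=R(\!(y;\delta)\!)_2$ be the ring of Laurent series $\sum_{i\ge m}f_iy^i$ ($m\in\mathbb{Z}$, $f_i\in R$) with the product determined by $$y^if=\sum_{k\ge 0}\Big(\prod_{j=1}^k\frac{2(j-1)+i}{j}\Big)\delta^k(f)\,y^{i+2k}\qquad(i\in\mathbb{Z},\ f\in R);$$ in particular $yf=\sum_{k\ge0}\frac{(2k)!}{2^k(k!)^2}\delta^k(f)y^{2k+1}$. Let $\Gamma$ be a group acting on the right by ring automorphisms on $C$ and stabilizing $R$, and put $C^\Gamma=\{q\in C: q\cdot\gamma=q\ \forall\gamma\in\Gamma\}$, $R^\Gamma=R\cap C^\Gamma$. Write $U(R)$ for the group of units of $R$. Then there is a (necessarily unique) map $s:\Gamma\to U(R)$, $\gamma\mapsto s_\gamma$, such that $y\cdot\gamma=s_\gamma^{-1}y+(\text{terms of higher degree in }y)$ for all $\gamma\in\Gamma$, and it is a $1$-cocycle: $s_{\gamma\gamma'}=(s_\gamma\cdot\gamma')s_{\gamma'}$ for all $\gamma,\gamma'\in\Gamma$. Suppose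 that $C^\Gamma$ contains an element $w=e^2y^{-2}+h$ with $h\in R$ and $e\in U(R)$ such that $e\cdot\gamma=s_\gamma^{-1}e$ for all $\gamma\in\Gamma$. Then the derivation $\Delta=e^2\delta$ restricts to a derivation of $R^\Gamma$. Moreover $w$ is invertible in $C$, there is a unique $v\in C$ with $v^2=w^{-1}$ and $v=e^{-1}y+(\text{terms of higher degree in }y)$, this $v$ is invertible, and $C^\Gamma=R^\Gamma(\!(v;\Delta)\!)_2$. That is, for every Laurent series $\sum_{i\ge m}f_iv^i$ with coefficients in $R^\Gamma$ the sum converges $y$-adically in $C$, and $\sum_{i\ge m} f_iv^i$ (formal) $\mapsto\sum_{i\ge m} f_iv^i$ (in $C$) is an injective ring homomorphism from $R^\Gamma(\!(v;\Delta)\!)_2$ (the ring defined as above from $R^\Gamma$, the restriction of $\Delta$, and the variable $v$) to $C$ with image $C^\Gamma$. -/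

import Mathlib

set_option linter.unusedSectionVars false

noncomputable section
namespace QuadPseudo

/-- The rational number `∏_{j=1}^k (2(j-1)+i)/j`. -/
def yCoef (i : ℤ) (k : ℕ) : ℚ := ∏ j ∈ Finset.range k, (2 * (j : ℚ) + (i : ℚ)) / ((j : ℚ) + 1)

theorem yCoef_zero (i : ℤ) : yCoef i 0 = 1 := by simp [yCoef]

theorem yCoef_succ (i : ℤ) (k : ℕ) :
    ((k : ℚ) + 1) * yCoef i (k + 1) = (2 * (k : ℚ) + i) * yCoef i k := by
  have : (k : ℚ) + 1 ≠ 0 := by positivity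
  rw [yCoef, Finset.prod_range_succ, ← yCoef]
  field_simp

theorem yCoef_zero_left (k : ℕ) (hk : k ≠ 0) : yCoef 0 k = 0 := by
  rw [yCoef, Finset.prod_eq_zero (i := 0)] <;> simp [Nat.pos_of_ne_zero hk]

theorem yCoef_comp (i : ℤ) (p q : ℕ) :
    yCoef (i + 2 * q) p * yCoef i q = ((p + q).choose p : ℚ) * yCoef i (p + q) := by
  induction p with
  | zero => simp [yCoef_zero]
  | succ p ih =>
    have h1 : (p : ℚ) + 1 ≠ 0 := by positivity
    have h2 := yCoef_succ (i + 2 * q) p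
    have h3 := yCoef_succ i (p + q)
    have h4 : ((p + q + 1 : ℕ) : ℚ) * ((p + q).choose p : ℚ)
        = ((p + 1 + q).choose (p + 1) : ℚ) * ((p : ℚ) + 1) := by
      have := Nat.add_one_mul_choose_eq (p + q) p
      rw [show p + 1 + q = p + q + 1 by ring]
      exact_mod_cast this
    rw [show p + 1 + q = p + q + 1 by ring] at *
    push_cast at h2 h3 h4
    apply mul_left_cancel₀ h1
    linear_combination yCoef i q * h2 + (2 * (p : ℚ) + (i + 2 * q)) * ih
      - ((p + q).choose p : ℚ) * h3 + yCoef i (p + q + 1) * h4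

theorem yCoef_add (i j : ℤ) (k : ℕ) :
    yCoef (i + j) k = ∑ p ∈ Finset.HasAntidiagonal.antidiagonal k, yCoef i p.1 * yCoef j p.2 := by
  induction k with
  | zero => simp [yCoef_zero]
  | succ k ih =>
    have h1 : (k : ℚ) + 1 ≠ 0 := by positivity
    apply mul_left_cancel₀ h1
    rw [yCoef_succ, ih, Finset.mul_sum, Finset.mul_sum]
    have e1 : ∑ p ∈ Finset.HasAntidiagonal.antidiagonal (k + 1), ((k : ℚ) + 1) * (yCoef i p.1 * yCoef j p.2)
        = ∑ p ∈ Finset.HasAntidiagonal.antidiagonal (k + 1), ((p.1 : ℚ) * yCoef i p.1 * yCoef j p.2)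
          + ∑ p ∈ Finset.HasAntidiagonal.antidiagonal (k + 1), (yCoef i p.1 * ((p.2 : ℚ) * yCoef j p.2)) := by
      rw [← Finset.sum_add_distrib]
      refine Finset.sum_congr rfl fun p hp => ?_
      have : ((p.1 + p.2 : ℕ) : ℚ) = ((k + 1 : ℕ) : ℚ) := by
        rw [Finset.HasAntidiagonal.mem_antidiagonal.mp hp]
      push_cast at this
      rw [← this]; ring
    rw [e1, Finset.Nat.sum_antidiagonal_succ, Finset.Nat.sum_antidiagonal_succ']
    simp only [Nat.cast_zero, zero_mul, mul_zero, zero_add, Nat.cast_add, Nat.cast_one,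
      yCoef_succ]
    rw [← Finset.sum_add_distrib]
    refine Finset.sum_congr rfl fun p hp => ?_
    have : ((p.1 + p.2 : ℕ) : ℚ) = (k : ℚ) := by
      rw [Finset.HasAntidiagonal.mem_antidiagonal.mp hp]
    push_cast at this ⊢
    rw [← this]; ring

variable {R : Type*} [CommRing R] [Algebra ℚ R]

/-- `∑ a_i y^i ↦ ∑ yCoef i k • a_i y^i`. -/
def scale (k : ℕ) (a : LaurentSeries R) : LaurentSeries R where
  coeff i := yCoef i k • a.coeff i
  isPWO_support' := a.isPWO_support.mono fun i hi h => hi (by simp [h])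

/-- `∑ a_i y^i ↦ ∑ yCoef i k • a_i y^(i+2k)`. -/
def shift (k : ℕ) (a : LaurentSeries R) : LaurentSeries R :=
  HahnSeries.single (2 * (k : ℤ)) 1 * scale k a

/-- `∑ a_i y^i ↦ ∑ δ^k(a_i) y^i`. -/
def diff (δ : Derivation ℤ R R) (k : ℕ) (a : LaurentSeries R) : LaurentSeries R :=
  a.map ((δ : R →ₗ[ℤ] R) ^ k)

theorem shift_coeff (k : ℕ) (a : LaurentSeries R) (n : ℤ) :
    (shift k a).coeff n = yCoef (n - 2 * k) k • a.coeff (n - 2 * k) := by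
  simp [shift, scale, HahnSeries.coeff_single_mul]

theorem mul_coeff_of_support {R : Type*} [CommRing R] {x y a b : LaurentSeries R}
    (hx : ∀ i, a.coeff i = 0 → x.coeff i = 0) (hy : ∀ i, b.coeff i = 0 → y.coeff i = 0) (n : ℤ) :
    (x * y).coeff n = ∑ ij ∈ Finset.antidiagonal a.isPWO_support b.isPWO_support n,
      x.coeff ij.1 * y.coeff ij.2 := by
  rw [HahnSeries.coeff_mul]
  refine Finset.sum_subset (fun ij h => ?_) (fun ij h h' => ?_)
  · rw [Finset.mem_antidiagonal] at h ⊢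
    exact ⟨fun h0 => h.1 (hx _ h0), fun h0 => h.2.1 (hy _ h0), h.2.2⟩
  · rw [Finset.mem_antidiagonal] at h h'
    by_contra hne
    exact h' ⟨left_ne_zero_of_mul hne, right_ne_zero_of_mul hne, h.2.2⟩

theorem scale_mul (k : ℕ) (a b : LaurentSeries R) :
    scale k (a * b) = ∑ p ∈ Finset.HasAntidiagonal.antidiagonal k, scale p.1 a * scale p.2 b := by
  ext n
  have h : ∀ p : ℕ × ℕ, (scale p.1 a * scale p.2 b).coeff n =
      ∑ ij ∈ Finset.antidiagonal a.isPWO_support b.isPWO_support n,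
        (yCoef ij.1 p.1 * yCoef ij.2 p.2) • (a.coeff ij.1 * b.coeff ij.2) := by
    intro p
    rw [mul_coeff_of_support (a := a) (b := b) (fun i h => by simp [scale, h])
      (fun i h => by simp [scale, h])]
    refine Finset.sum_congr rfl fun ij _ => ?_
    simp [scale, smul_smul, mul_comm]
  rw [HahnSeries.coeff_sum]
  simp only [h]
  rw [Finset.sum_comm]
  simp only [← Finset.sum_smul, ← yCoef_add]
  change yCoef n k • (a * b).coeff n = _
  rw [HahnSeries.coeff_mul, Finset.smul_sum]
  refine Finset.sum_congr rfl fun ij hij => ?_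
  rw [(Finset.mem_antidiagonal.mp hij).2.2]

theorem shift_mul (k : ℕ) (a b : LaurentSeries R) :
    shift k (a * b) = ∑ p ∈ Finset.HasAntidiagonal.antidiagonal k, shift p.1 a * shift p.2 b := by
  rw [shift, scale_mul, Finset.mul_sum]
  refine Finset.sum_congr rfl fun p hp => ?_
  have : HahnSeries.single (2 * (k : ℤ)) (1 : R)
      = HahnSeries.single (2 * (p.1 : ℤ)) (1 : R) * HahnSeries.single (2 * (p.2 : ℤ)) (1 : R) := by
    rw [HahnSeries.single_mul_single, mul_one, ← Finset.HasAntidiagonal.mem_antidiagonal.mp hp]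
    push_cast; ring_nf
  rw [this, shift, shift]; ring

theorem shift_shift (p q : ℕ) (a : LaurentSeries R) :
    shift p (shift q a) = (p + q).choose p • shift (p + q) a := by
  ext n
  rw [HahnSeries.coeff_smul]
  simp only [shift_coeff]
  rw [smul_smul, ← Nat.cast_smul_eq_nsmul ℚ, smul_smul,
    show n - 2 * (p : ℤ) - 2 * (q : ℤ) = n - 2 * ((p + q : ℕ) : ℤ) by push_cast; ring,
    ← yCoef_comp]
  congr 3
  push_cast; ring

theorem shift_add (k : ℕ) (a b : LaurentSeries R) : shift k (a + b) = shift k a + shift k b := by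
  ext n; simp [shift_coeff]

theorem shift_zero_left (a : LaurentSeries R) : shift 0 a = a := by
  ext n; simp [shift_coeff, yCoef_zero]

theorem diff_add (δ : Derivation ℤ R R) (k : ℕ) (a b : LaurentSeries R) :
    diff δ k (a + b) = diff δ k a + diff δ k b := by
  ext n; simp [diff]

theorem diff_zero_left (δ : Derivation ℤ R R) (a : LaurentSeries R) : diff δ 0 a = a := by
  ext n; simp [diff]

theorem diff_diff (δ : Derivation ℤ R R) (p q : ℕ) (a : LaurentSeries R) :
    diff δ p (diff δ q a) = diff δ (p + q) a := by
  ext n; simp [diff, pow_add]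

theorem map_pow_smul (δ : Derivation ℤ R R) (k : ℕ) (c : ℚ) (f : R) :
    ((δ : R →ₗ[ℤ] R) ^ k) (c • f) = c • ((δ : R →ₗ[ℤ] R) ^ k) f :=
  map_rat_smul ((δ : R →ₗ[ℤ] R) ^ k) c f

theorem diff_shift (δ : Derivation ℤ R R) (p q : ℕ) (a : LaurentSeries R) :
    diff δ p (shift q a) = shift q (diff δ p a) := by
  ext n; simp [diff, shift_coeff, map_pow_smul]

theorem pow_mul (δ : Derivation ℤ R R) (k : ℕ) (f g : R) :
    ((δ : R →ₗ[ℤ] R) ^ k) (f * g) = ∑ p ∈ Finset.HasAntidiagonal.antidiagonal k,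
      k.choose p.1 • (((δ : R →ₗ[ℤ] R) ^ p.1) f * ((δ : R →ₗ[ℤ] R) ^ p.2) g) := by
  induction k with
  | zero => simp
  | succ k ih =>
    rw [Finset.sum_antidiagonal_choose_succ_nsmul
      (fun p q => ((δ : R →ₗ[ℤ] R) ^ p) f * ((δ : R →ₗ[ℤ] R) ^ q) g), pow_succ',
      Module.End.mul_apply, ih, map_sum, ← Finset.sum_add_distrib]
    refine Finset.sum_congr rfl fun p hp => ?_
    rw [map_nsmul, Nat.choose_symm_of_eq_add (Finset.HasAntidiagonal.mem_antidiagonal.mp hp).symm,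
      ← smul_add, Derivation.coeFn_coe, Derivation.leibniz, pow_succ', pow_succ']
    simp [mul_comm]

theorem diff_mul (δ : Derivation ℤ R R) (k : ℕ) (a b : LaurentSeries R) :
    diff δ k (a * b) = ∑ p ∈ Finset.HasAntidiagonal.antidiagonal k,
      k.choose p.1 • (diff δ p.1 a * diff δ p.2 b) := by
  ext n
  have h : ∀ p : ℕ × ℕ, (diff δ p.1 a * diff δ p.2 b).coeff n =
      ∑ ij ∈ Finset.antidiagonal a.isPWO_support b.isPWO_support n,
        (((δ : R →ₗ[ℤ] R) ^ p.1) (a.coeff ij.1) * ((δ : R →ₗ[ℤ] R) ^ p.2) (b.coeff ij.2)) := by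
    intro p
    exact mul_coeff_of_support (fun i h => by simp [diff, h]) (fun i h => by simp [diff, h]) n
  rw [HahnSeries.coeff_sum]
  simp only [HahnSeries.coeff_smul, h, Finset.smul_sum]
  rw [Finset.sum_comm]
  change ((δ : R →ₗ[ℤ] R) ^ k) ((a * b).coeff n) = _
  rw [HahnSeries.coeff_mul, map_sum]
  exact Finset.sum_congr rfl fun ij _ => pow_mul δ k _ _

/-- All coefficients of index `< A` vanish. -/
def Low (A : ℤ) (a : LaurentSeries R) : Prop := ∀ i < A, a.coeff i = 0

theorem exists_low (a : LaurentSeries R) : ∃ A, Low A a :=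
  ⟨a.order, fun _ hi => HahnSeries.coeff_eq_zero_of_lt_order hi⟩

theorem Low.mono {A B : ℤ} {a : LaurentSeries R} (h : Low B a) (hAB : A ≤ B) : Low A a :=
  fun i hi => h i (lt_of_lt_of_le hi hAB)

theorem Low.mul {A B : ℤ} {a b : LaurentSeries R} (ha : Low A a) (hb : Low B b) :
    Low (A + B) (a * b) := by
  intro n hn
  rw [HahnSeries.coeff_mul]
  refine Finset.sum_eq_zero fun ij h => ?_
  rw [Finset.mem_antidiagonal] at h
  rcases lt_or_ge ij.1 A with h1 | h1
  · rw [ha _ h1, zero_mul]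
  · rw [hb ij.2 (by omega), mul_zero]

theorem Low.shift {A : ℤ} {a : LaurentSeries R} (ha : Low A a) (k : ℕ) :
    Low (A + 2 * k) (shift k a) := by
  intro n hn
  rw [shift_coeff, ha _ (by omega), smul_zero]

theorem Low.diff (δ : Derivation ℤ R R) {A : ℤ} {a : LaurentSeries R} (ha : Low A a) (k : ℕ) :
    Low A (diff δ k a) := by
  intro n hn
  simp [QuadPseudo.diff, ha n hn]

/-- The summand `∑ yCoef i k • a_i δ^k(b_j) y^(i+j+2k)` of the product. -/
def term (δ : Derivation ℤ R R) (k : ℕ) (a b : LaurentSeries R) : LaurentSeries R :=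
  shift k a * diff δ k b

theorem Low.term (δ : Derivation ℤ R R) {A B : ℤ} {a b : LaurentSeries R} (ha : Low A a)
    (hb : Low B b) (k : ℕ) : Low (A + B + 2 * k) (term δ k a b) :=
  ((ha.shift k).mul (hb.diff δ k)).mono (by omega)

theorem term_add_left (δ : Derivation ℤ R R) (k : ℕ) (a b c : LaurentSeries R) :
    term δ k (a + b) c = term δ k a c + term δ k b c := by
  simp only [term, shift_add, add_mul]

theorem term_add_right (δ : Derivation ℤ R R) (k : ℕ) (a b c : LaurentSeries R) :
    term δ k a (b + c) = term δ k a b + term δ k a c := by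
  simp only [term, diff_add, mul_add]

theorem finsum_term (δ : Derivation ℤ R R) {A B n : ℤ} {K : ℕ} {a b : LaurentSeries R}
    (ha : Low A a) (hb : Low B b) (hn : n < A + B + 2 * K) :
    ∑ᶠ k, (term δ k a b).coeff n = ∑ k ∈ Finset.range K, (term δ k a b).coeff n := by
  refine finsum_eq_sum_of_support_subset _ fun k hk => ?_
  by_contra h
  simp only [Finset.coe_range, Set.mem_Iio, not_lt] at h
  exact hk (ha.term δ hb k n (by omega))

/-- The product of two Laurent series in `y` for the commutation law
`y^i f = ∑_k yCoef i k • δ^k(f) y^(i+2k)`; each coefficient is a finite sum. -/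
def star (δ : Derivation ℤ R R) (a b : LaurentSeries R) : LaurentSeries R :=
  HahnSeries.ofSuppBddBelow (fun n => ∑ᶠ k, (term δ k a b).coeff n) (by
    obtain ⟨A, ha⟩ := exists_low a
    obtain ⟨B, hb⟩ := exists_low b
    refine ⟨A + B, fun n hn => ?_⟩
    by_contra h
    exact hn (by simpa using finsum_term δ (K := 0) ha hb (by simpa using h)))

theorem star_coeff (δ : Derivation ℤ R R) {A B n : ℤ} {K : ℕ} {a b : LaurentSeries R}
    (ha : Low A a) (hb : Low B b) (hn : n < A + B + 2 * K) :
    (star δ a b).coeff n = ∑ k ∈ Finset.range K, (term δ k a b).coeff n :=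
  finsum_term δ ha hb hn

theorem exists_bound (A B n : ℤ) : ∃ K : ℕ, n < A + B + 2 * K :=
  ⟨(n - A - B).toNat + 1, by omega⟩

theorem Low.add {A : ℤ} {a b : LaurentSeries R} (ha : Low A a) (hb : Low A b) : Low A (a + b) :=
  fun i hi => by rw [HahnSeries.coeff_add, ha i hi, hb i hi, add_zero]

theorem star_add_left (δ : Derivation ℤ R R) (a b c : LaurentSeries R) :
    star δ (a + b) c = star δ a c + star δ b c := by
  obtain ⟨A, ha⟩ := exists_low a
  obtain ⟨B, hb⟩ := exists_low b
  obtain ⟨C, hc⟩ := exists_low c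
  have ha' := ha.mono (min_le_left A B)
  have hb' := hb.mono (min_le_right A B)
  ext n
  obtain ⟨K, hK⟩ := exists_bound (min A B) C n
  rw [HahnSeries.coeff_add, star_coeff δ ha' hc hK, star_coeff δ hb' hc hK,
    star_coeff δ (ha'.add hb') hc hK, ← Finset.sum_add_distrib]
  simp only [term_add_left, HahnSeries.coeff_add]

theorem star_add_right (δ : Derivation ℤ R R) (a b c : LaurentSeries R) :
    star δ a (b + c) = star δ a b + star δ a c := by
  obtain ⟨A, ha⟩ := exists_low a
  obtain ⟨B, hb⟩ := exists_low b
  obtain ⟨C, hc⟩ := exists_low c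
  have hb' := hb.mono (min_le_left B C)
  have hc' := hc.mono (min_le_right B C)
  ext n
  obtain ⟨K, hK⟩ := exists_bound A (min B C) n
  rw [HahnSeries.coeff_add, star_coeff δ ha hb' hK, star_coeff δ ha hc' hK,
    star_coeff δ ha (hb'.add hc') hK, ← Finset.sum_add_distrib]
  simp only [term_add_right, HahnSeries.coeff_add]

theorem low_star (δ : Derivation ℤ R R) {A B : ℤ} {a b : LaurentSeries R} (ha : Low A a)
    (hb : Low B b) : Low (A + B) (star δ a b) := by
  intro n hn
  simpa using star_coeff δ (K := 0) ha hb (by simpa using hn)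

/-- The truncated product. -/
def trunc (δ : Derivation ℤ R R) (K : ℕ) (a b : LaurentSeries R) : LaurentSeries R :=
  ∑ k ∈ Finset.range K, term δ k a b

theorem star_eq_trunc_add (δ : Derivation ℤ R R) {A B : ℤ} {a b : LaurentSeries R} (ha : Low A a)
    (hb : Low B b) (K : ℕ) : ∃ r, Low (A + B + 2 * K) r ∧ star δ a b = trunc δ K a b + r := by
  refine ⟨star δ a b - trunc δ K a b, fun n hn => ?_, by ring⟩
  rw [HahnSeries.coeff_sub, star_coeff δ ha hb hn, trunc, HahnSeries.coeff_sum, sub_self]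

theorem low_trunc (δ : Derivation ℤ R R) {A B : ℤ} {a b : LaurentSeries R} (ha : Low A a)
    (hb : Low B b) (K : ℕ) : Low (A + B) (trunc δ K a b) := by
  intro n hn
  rw [trunc, HahnSeries.coeff_sum]
  exact Finset.sum_eq_zero fun k _ => ha.term δ hb k n (by omega)

theorem sum_range_antidiagonal {M : Type*} [AddCommMonoid M] (K : ℕ) (g : ℕ → ℕ → M)
    (hg : ∀ p q, K ≤ p + q → g p q = 0) :
    ∑ k ∈ Finset.range K, ∑ p ∈ Finset.HasAntidiagonal.antidiagonal k, g p.1 p.2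
      = ∑ p ∈ Finset.range K, ∑ q ∈ Finset.range K, g p q := by
  rw [← Finset.sum_product' (Finset.range K) (Finset.range K) g,
    ← Finset.sum_filter_of_ne (p := fun x : ℕ × ℕ => x.1 + x.2 < K)
      (fun x _ hx => by by_contra h; exact hx (hg _ _ (not_lt.mp h))),
    Finset.sum_sigma']
  refine Finset.sum_bij' (fun x _ => x.2) (fun x _ => ⟨x.1 + x.2, x⟩) ?_ ?_ ?_ ?_ ?_
  · rintro ⟨k, p, q⟩ h
    simp at h ⊢
    omega
  · rintro ⟨p, q⟩ h
    simp at h ⊢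
    omega
  · rintro ⟨k, p, q⟩ h
    simp at h
    obtain ⟨h1, rfl⟩ := h
    rfl
  · rintro ⟨p, q⟩ h
    rfl
  · rintro ⟨k, p, q⟩ h
    rfl

/-- The common summand of the two ways of bracketing a triple product. -/
def triple (δ : Derivation ℤ R R) (a b c : LaurentSeries R) (p q l : ℕ) : LaurentSeries R :=
  (p + l).choose p • (shift (p + l) a * shift q (diff δ l b) * diff δ (p + q) c)

theorem term_term_left (δ : Derivation ℤ R R) (a b c : LaurentSeries R) (k l : ℕ) :
    term δ k (term δ l a b) c
      = ∑ p ∈ Finset.HasAntidiagonal.antidiagonal k, triple δ a b c p.1 p.2 l := by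
  rw [term, term, shift_mul, Finset.sum_mul]
  refine Finset.sum_congr rfl fun p hp => ?_
  rw [shift_shift, triple, Finset.HasAntidiagonal.mem_antidiagonal.mp hp, smul_mul_assoc,
    smul_mul_assoc]

theorem term_term_right (δ : Derivation ℤ R R) (a b c : LaurentSeries R) (k q : ℕ) :
    term δ k a (term δ q b c)
      = ∑ p ∈ Finset.HasAntidiagonal.antidiagonal k, triple δ a b c p.1 q p.2 := by
  rw [term, term, diff_mul, Finset.mul_sum, ← Finset.Nat.sum_antidiagonal_swap]
  refine Finset.sum_congr rfl fun p hp => ?_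
  have hp := Finset.HasAntidiagonal.mem_antidiagonal.mp hp
  rw [diff_shift, diff_diff, triple, hp, mul_smul_comm, ← mul_assoc, Prod.fst_swap, Prod.snd_swap,
    Nat.choose_symm_of_eq_add hp.symm]

theorem trunc_add_left (δ : Derivation ℤ R R) (K : ℕ) (a b c : LaurentSeries R) :
    trunc δ K (a + b) c = trunc δ K a c + trunc δ K b c := by
  simp only [trunc, term_add_left, Finset.sum_add_distrib]

theorem star_assoc (δ : Derivation ℤ R R) (a b c : LaurentSeries R) :
    star δ (star δ a b) c = star δ a (star δ b c) := by
  obtain ⟨A, ha⟩ := exists_low a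
  obtain ⟨B, hb⟩ := exists_low b
  obtain ⟨C, hc⟩ := exists_low c
  ext n
  obtain ⟨K, hK⟩ := exists_bound (A + B) C n
  have hF : ∀ p q l, K ≤ p + q + l → (triple δ a b c p q l).coeff n = 0 := by
    intro p q l h
    rw [triple, HahnSeries.coeff_smul]
    have := (((ha.shift (p + l)).mul ((hb.diff δ l).shift q)).mul (hc.diff δ (p + q))) n
      (by push_cast; omega)
    rw [this, smul_zero]
  have hsumL : ∀ (k : ℕ) (x : ℕ → LaurentSeries R), term δ k (∑ l ∈ Finset.range K, x l) c
      = ∑ l ∈ Finset.range K, term δ k (x l) c := fun k x =>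
    map_sum (AddMonoidHom.mk' (fun y => term δ k y c) fun y z => term_add_left δ k y z c) x _
  have hsumR : ∀ (k : ℕ) (x : ℕ → LaurentSeries R), term δ k a (∑ l ∈ Finset.range K, x l)
      = ∑ l ∈ Finset.range K, term δ k a (x l) := fun k x =>
    map_sum (AddMonoidHom.mk' (fun y => term δ k a y) fun y z => term_add_right δ k a y z) x _
  obtain ⟨r, hr, hr'⟩ := star_eq_trunc_add δ ha hb K
  obtain ⟨s, hs, hs'⟩ := star_eq_trunc_add δ hb hc K
  rw [hr', hs', star_add_left, star_add_right, HahnSeries.coeff_add, HahnSeries.coeff_add,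
    low_star δ hr hc n (by omega), low_star δ ha hs n (by omega),
    star_coeff δ (low_trunc δ ha hb K) hc hK,
    star_coeff δ ha (low_trunc δ hb hc K) (K := K) (by omega)]
  simp only [trunc, hsumL, hsumR, term_term_left, term_term_right, HahnSeries.coeff_sum, add_zero]
  rw [Finset.sum_comm]
  rw [Finset.sum_congr rfl fun l _ => sum_range_antidiagonal K
      (fun p q => (triple δ a b c p q l).coeff n) fun p q h => hF _ _ _ (by omega)]
  symm
  rw [Finset.sum_comm]
  rw [Finset.sum_congr rfl fun q _ => sum_range_antidiagonal K
      (fun p l => (triple δ a b c p q l).coeff n) fun p l h => hF _ _ _ (by omega)]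
  rw [Finset.sum_comm]
  conv_rhs => rw [Finset.sum_comm]
  exact Finset.sum_congr rfl fun p _ => Finset.sum_comm

theorem shift_one (k : ℕ) (hk : k ≠ 0) : shift k (1 : LaurentSeries R) = 0 := by
  ext n
  rw [shift_coeff, HahnSeries.coeff_one]
  split_ifs with h
  · rw [h, yCoef_zero_left k hk, zero_smul, HahnSeries.coeff_zero]
  · simp

theorem diff_one (δ : Derivation ℤ R R) (k : ℕ) (hk : k ≠ 0) : diff δ k (1 : LaurentSeries R) = 0 := by
  ext n
  obtain ⟨m, rfl⟩ := Nat.exists_eq_succ_of_ne_zero hk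
  change ((δ : R →ₗ[ℤ] R) ^ (m + 1)) ((1 : LaurentSeries R).coeff n) = 0
  rw [HahnSeries.coeff_one, pow_succ, Module.End.mul_apply]
  split_ifs <;> simp

theorem one_star (δ : Derivation ℤ R R) (a : LaurentSeries R) : star δ 1 a = a := by
  ext n
  change ∑ᶠ k, (term δ k 1 a).coeff n = _
  rw [finsum_eq_single _ 0 fun k hk => by simp [term, shift_one k hk]]
  simp [term, shift_zero_left, diff_zero_left]

theorem star_one (δ : Derivation ℤ R R) (a : LaurentSeries R) : star δ a 1 = a := by
  ext n
  change ∑ᶠ k, (term δ k a 1).coeff n = _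
  rw [finsum_eq_single _ 0 fun k hk => by simp [term, diff_one δ k hk]]
  simp [term, shift_zero_left, diff_zero_left]

end QuadPseudo

open QuadPseudo

/-- The ring `R((y ; δ))_2` of quadratic formal pseudodifferential operators: Laurent series
`∑_{i ≥ m} f_i y^i` with coefficients in `R` written on the left, multiplied by means of
`y^i f = ∑_k (∏_{j=1}^k (2(j-1)+i)/j) δ^k(f) y^(i+2k)`. -/
@[ext]
structure QuadPseudoDiff (R : Type*) [CommRing R] [Algebra ℚ R] (δ : Derivation ℤ R R) where
  toSeries : LaurentSeries R

namespace QuadPseudoDiff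

variable {R : Type*} [CommRing R] [Algebra ℚ R] {δ : Derivation ℤ R R}

instance : Zero (QuadPseudoDiff R δ) := ⟨⟨0⟩⟩
instance : One (QuadPseudoDiff R δ) := ⟨⟨1⟩⟩
instance : Add (QuadPseudoDiff R δ) := ⟨fun a b => ⟨a.toSeries + b.toSeries⟩⟩
instance : Neg (QuadPseudoDiff R δ) := ⟨fun a => ⟨-a.toSeries⟩⟩
instance : Sub (QuadPseudoDiff R δ) := ⟨fun a b => ⟨a.toSeries - b.toSeries⟩⟩
instance : SMul ℕ (QuadPseudoDiff R δ) := ⟨fun n a => ⟨n • a.toSeries⟩⟩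
instance : SMul ℤ (QuadPseudoDiff R δ) := ⟨fun n a => ⟨n • a.toSeries⟩⟩
instance : Mul (QuadPseudoDiff R δ) := ⟨fun a b => ⟨star δ a.toSeries b.toSeries⟩⟩

theorem toSeries_injective :
    Function.Injective (toSeries : QuadPseudoDiff R δ → LaurentSeries R) :=
  fun _ _ h => QuadPseudoDiff.ext h

instance : AddCommGroup (QuadPseudoDiff R δ) :=
  toSeries_injective.addCommGroup toSeries rfl (fun _ _ => rfl) (fun _ => rfl) (fun _ _ => rfl)
    (fun _ _ => rfl) (fun _ _ => rfl)

instance : Ring (QuadPseudoDiff R δ) :=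
  { (inferInstance : AddCommGroup (QuadPseudoDiff R δ)) with
    mul := (· * ·)
    one := 1
    left_distrib := fun _ _ _ => toSeries_injective (star_add_right δ _ _ _)
    right_distrib := fun _ _ _ => toSeries_injective (star_add_left δ _ _ _)
    zero_mul := fun a => by
      have h := star_add_left δ 0 0 a.toSeries
      rw [add_zero, left_eq_add] at h
      exact toSeries_injective h
    mul_zero := fun a => by
      have h := star_add_right δ a.toSeries 0 0
      rw [add_zero, left_eq_add] at h
      exact toSeries_injective h
    mul_assoc := fun _ _ _ => toSeries_injective (star_assoc δ _ _ _)
    one_mul := fun _ => toSeries_injective (one_star δ _)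
    mul_one := fun _ => toSeries_injective (star_one δ _) }

/-- The coefficient of `y^i`. -/
def coeff (q : QuadPseudoDiff R δ) (i : ℤ) : R := q.toSeries.coeff i

/-- The element `f y^i`. -/
def monomial (f : R) (i : ℤ) : QuadPseudoDiff R δ := ⟨HahnSeries.single i f⟩

/-- The multiplication rule on monomials. -/
theorem monomial_mul_monomial_coeff (f g : R) (i j n : ℤ) :
    ((monomial f i * monomial g j : QuadPseudoDiff R δ)).coeff n
      = ∑ᶠ k : ℕ, if n = i + j + 2 * k then
          yCoef i k • (f * ((δ : R →ₗ[ℤ] R) ^ k) g) else 0 := by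
  change ∑ᶠ k, (term δ k (HahnSeries.single i f) (HahnSeries.single j g)).coeff n = _
  refine finsum_congr fun k => ?_
  have h1 : shift k (HahnSeries.single i f) = HahnSeries.single (i + 2 * k) (yCoef i k • f) := by
    ext m
    rw [shift_coeff, HahnSeries.coeff_single, HahnSeries.coeff_single]
    by_cases h : m = i + 2 * k
    · rw [if_pos h, if_pos (by omega)]
      congr 2
      omega
    · rw [if_neg h, if_neg (by omega), smul_zero]
  have h2 : diff δ k (HahnSeries.single j g)
      = HahnSeries.single j (((δ : R →ₗ[ℤ] R) ^ k) g) := by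
    ext m
    change ((δ : R →ₗ[ℤ] R) ^ k) ((HahnSeries.single j g).coeff m) = _
    rw [HahnSeries.coeff_single, HahnSeries.coeff_single]
    split_ifs <;> simp
  rw [term, h1, h2, HahnSeries.single_mul_single, HahnSeries.coeff_single, smul_mul_assoc,
    show i + 2 * (k : ℤ) + j = i + j + 2 * k by ring]
  congr

/-- The inclusion of `R` as the series `f y^0`. -/
def C : R →+* QuadPseudoDiff R δ where
  toFun f := monomial f 0
  map_one' := rfl
  map_zero' := toSeries_injective (HahnSeries.single_eq_zero)
  map_add' f g := toSeries_injective (HahnSeries.single_add 0 f g)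
  map_mul' f g := by
    apply toSeries_injective
    ext n
    refine Eq.trans ?_ (monomial_mul_monomial_coeff (δ := δ) f g 0 0 n).symm
    rw [finsum_eq_single _ 0 fun k hk => by simp [yCoef_zero_left k hk]]
    simp [monomial, yCoef_zero, HahnSeries.coeff_single]

/-- `q = f y^m + (terms of higher degree)`. -/
def StartsWith (q : QuadPseudoDiff R δ) (f : R) (m : ℤ) : Prop :=
  q.coeff m = f ∧ ∀ i < m, q.coeff i = 0

/-- `q = ∑_i f_i v^i`, the series (over those `i` with `f_i ≠ 0`) being convergent for the
`y`-adic topology: each coefficient of the partial sums is eventually that of `q`, uniformly for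
the coefficients of index at most `n`. -/
def IsSeriesIn (v : (QuadPseudoDiff R δ)ˣ) (f : ℤ → R) (q : QuadPseudoDiff R δ) : Prop :=
  ∀ n : ℤ, ∀ᶠ M : ℕ in Filter.atTop, ∀ j ≤ n,
    (∑ i ∈ Finset.Icc (-(M : ℤ)) (M : ℤ),
      C (f i) * ((v ^ i : (QuadPseudoDiff R δ)ˣ) : QuadPseudoDiff R δ)).coeff j = q.coeff j

section Action

variable (Γ : Type*) [Group Γ] (δ) [MulSemiringAction Γᵐᵒᵖ (QuadPseudoDiff R δ)]

/-- The invariant ring `R^Γ` for an action on `R((y ; δ))_2`; right actions of `Γ` are left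
actions of the opposite group, so that `q · γ` is `MulOpposite.op γ • q`. -/
def invariantCoeffs : Subalgebra ℚ R where
  carrier := {f | ∀ γ : Γ, MulOpposite.op γ • (C f : QuadPseudoDiff R δ) = C f}
  mul_mem' ha hb γ := by rw [map_mul, smul_mul', ha γ, hb γ]
  add_mem' ha hb γ := by rw [map_add, smul_add, ha γ, hb γ]
  algebraMap_mem' c γ :=
    RingHom.congr_fun (RingHom.ext_rat
      (((MulSemiringAction.toRingHom Γᵐᵒᵖ (QuadPseudoDiff R δ) (MulOpposite.op γ)).comp C).comp
        (algebraMap ℚ R)) (C.comp (algebraMap ℚ R))) c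

end Action

end QuadPseudoDiff

end

open QuadPseudoDiff

/-! Everything rests on the filtration by order in `y`: leading coefficients multiply as in a
commutative ring, and the ring is complete (`exists_limit`). Solving term by term
(`exists_root_of_step`) gives inverses of series with unit leading coefficient and, as 2 is
invertible, square roots with a prescribed leading term; the latter are unique over a domain.

No continuity of the action is assumed; it is automatic. A series `1 + (positive order)` has
`2^k`-th roots for every `k`, whereas an element with such roots must have order 0. This algebraic
property survives any automorphism, and together with stability of `R` it forces the automorphism to
send `y` to a unit times `y` plus higher terms and to respect orders
(`Stabilizes.exists_startsWith_y`, `Stabilizes.isLow`). Comparing leading coefficients of `y·γγ'`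
and `(y·γ)·γ'` gives the cocycle identity.

The commutator of `w` with `f` is `-2e²δ(f)`, so `Δ` preserves `R^Γ`. If `v² = w⁻¹` and `v = e⁻¹y +
...`, then `v·γ` is another square root of `w⁻¹`; the condition on `e` makes its leading term equal
to that of `v`, so uniqueness shows that `v` is invariant.

The substitution `y ↦ v` is multiplicative although only the relation for `v⁻² = w` is known:
`substAdd_y_mul` passes from the square to `v` itself by an order argument. Injectivity is read off
leading terms. For surjectivity onto the invariants, multiply an invariant series of order `n` by
`v^(-n)`: its constant term lies in `R^Γ`, so the leading term can be removed by some `f vⁿ`, and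
completeness finishes the argument (`exists_substAdd_eq`). -/

namespace QuadPseudoDiff

open QuadPseudo

/-! ### Orders, leading terms, completeness, inverses and square roots. -/

section Basic

variable {R : Type*} [CommRing R] [Algebra ℚ R] {δ : Derivation ℤ R R}

/-- All coefficients of index `< n` vanish. -/
def IsLow (n : ℤ) (q : QuadPseudoDiff R δ) : Prop := ∀ i < n, q.coeff i = 0

theorem coeff_injective : Function.Injective (coeff : QuadPseudoDiff R δ → ℤ → R) :=
  fun _ _ h => toSeries_injective (HahnSeries.ext h)

@[simp] theorem coeff_zero (n : ℤ) : (0 : QuadPseudoDiff R δ).coeff n = 0 := rfl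

@[simp] theorem coeff_add (p q : QuadPseudoDiff R δ) (n : ℤ) :
    (p + q).coeff n = p.coeff n + q.coeff n := rfl

@[simp] theorem coeff_neg (q : QuadPseudoDiff R δ) (n : ℤ) : (-q).coeff n = -q.coeff n := rfl

@[simp] theorem coeff_sub (p q : QuadPseudoDiff R δ) (n : ℤ) :
    (p - q).coeff n = p.coeff n - q.coeff n :=
  HahnSeries.coeff_sub

/-- The `n`-th coefficient as an additive map. -/
def coeffHom (n : ℤ) : QuadPseudoDiff R δ →+ R where
  toFun q := q.coeff n
  map_zero' := rfl
  map_add' _ _ := rfl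

theorem coeff_sum {ι : Type*} (s : Finset ι) (q : ι → QuadPseudoDiff R δ) (n : ℤ) :
    (∑ i ∈ s, q i).coeff n = ∑ i ∈ s, (q i).coeff n :=
  map_sum (coeffHom n) q s

theorem coeff_monomial (f : R) (i n : ℤ) :
    (monomial f i : QuadPseudoDiff R δ).coeff n = if n = i then f else 0 := by
  rw [coeff, monomial, HahnSeries.coeff_single]
  split_ifs <;> rfl

theorem coeff_C (f : R) (n : ℤ) :
    (C f : QuadPseudoDiff R δ).coeff n = if n = 0 then f else 0 :=
  coeff_monomial f 0 n

theorem coeff_one (n : ℤ) : (1 : QuadPseudoDiff R δ).coeff n = if n = 0 then 1 else 0 := by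
  rw [← map_one (C : R →+* QuadPseudoDiff R δ), coeff_C]

theorem C_injective : Function.Injective (C : R →+* QuadPseudoDiff R δ) := fun f g h => by
  simpa [coeff_C] using congrArg (fun q => q.coeff 0) h

theorem exists_isLow (q : QuadPseudoDiff R δ) : ∃ n, IsLow n q := exists_low q.toSeries

theorem isLow_zero (n : ℤ) : IsLow n (0 : QuadPseudoDiff R δ) := fun _ _ => rfl

theorem IsLow.mono {m n : ℤ} {q : QuadPseudoDiff R δ} (h : IsLow n q) (hmn : m ≤ n) :
    IsLow m q := fun i hi => h i (by omega)

theorem IsLow.add {n : ℤ} {p q : QuadPseudoDiff R δ} (hp : IsLow n p) (hq : IsLow n q) :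
    IsLow n (p + q) := fun i hi => by rw [coeff_add, hp i hi, hq i hi, add_zero]

theorem IsLow.sub {n : ℤ} {p q : QuadPseudoDiff R δ} (hp : IsLow n p) (hq : IsLow n q) :
    IsLow n (p - q) := fun i hi => by rw [coeff_sub, hp i hi, hq i hi, sub_zero]

theorem IsLow.neg {n : ℤ} {q : QuadPseudoDiff R δ} (hq : IsLow n q) :
    IsLow n (-q) := fun i hi => by rw [coeff_neg, hq i hi, neg_zero]

theorem IsLow.mul {m n : ℤ} {p q : QuadPseudoDiff R δ} (hp : IsLow m p) (hq : IsLow n q) :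
    IsLow (m + n) (p * q) := low_star δ hp hq

theorem IsLow.succ {n : ℤ} {q : QuadPseudoDiff R δ} (hq : IsLow n q) (h : q.coeff n = 0) :
    IsLow (n + 1) q := fun i hi => by
  rcases (Int.lt_add_one_iff.mp hi).lt_or_eq with h' | rfl
  exacts [hq i h', h]

theorem isLow_monomial (f : R) (i : ℤ) : IsLow i (monomial f i : QuadPseudoDiff R δ) :=
  fun j hj => by rw [coeff_monomial, if_neg (by omega)]

theorem isLow_C (f : R) : IsLow 0 (C f : QuadPseudoDiff R δ) := isLow_monomial f 0

theorem isLow_one : IsLow 0 (1 : QuadPseudoDiff R δ) := isLow_monomial 1 0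

theorem eq_zero_of_isLow {q : QuadPseudoDiff R δ} (h : ∀ n, IsLow n q) : q = 0 :=
  coeff_injective (funext fun n => h (n + 1) n (by omega))

theorem eq_zero_of_isLow_nat {q : QuadPseudoDiff R δ} (m : ℤ) (h : ∀ n : ℕ, IsLow (m + n) q) :
    q = 0 :=
  eq_zero_of_isLow fun n => (h (n - m).toNat).mono (by omega)

/-- The `k`-th correction in the product raises orders by `2k`, so only `k = 0`, the commutative
product, reaches the lowest degree. -/
theorem coeff_mul_of_isLow {m n : ℤ} {p q : QuadPseudoDiff R δ} (hp : IsLow m p)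
    (hq : IsLow n q) : (p * q).coeff (m + n) = p.coeff m * q.coeff n := by
  change (star δ p.toSeries q.toSeries).coeff (m + n) = _
  rw [star_coeff δ (K := 1) hp hq (by simp), Finset.sum_range_one, term, shift_zero_left,
    diff_zero_left, HahnSeries.coeff_mul]
  refine Finset.sum_eq_single (m, n) (fun ij h hne => ?_) fun h => ?_
  · rw [Finset.mem_antidiagonal] at h
    rcases lt_trichotomy ij.1 m with h1 | h1 | h1
    · rw [show p.toSeries.coeff ij.1 = 0 from hp _ h1, zero_mul]
    · exact absurd (Prod.ext h1 (by simpa [h1] using h.2.2)) hne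
    · have := h.2.2
      rw [show q.toSeries.coeff ij.2 = 0 from hq _ (by omega), mul_zero]
  · by_contra hne
    exact h (Finset.mem_antidiagonal.mpr
      ⟨left_ne_zero_of_mul hne, right_ne_zero_of_mul hne, rfl⟩)

theorem coeff_C_mul (f : R) (q : QuadPseudoDiff R δ) (n : ℤ) :
    (C f * q).coeff n = f * q.coeff n := by
  change ∑ᶠ k, (term δ k (HahnSeries.single 0 f) q.toSeries).coeff n = _
  rw [finsum_eq_single _ 0]
  · simp [term, shift_zero_left, diff_zero_left, coeff]
  · intro k hk
    have : shift k (HahnSeries.single 0 f) = (0 : LaurentSeries R) := by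
      ext m
      rw [shift_coeff, HahnSeries.coeff_single]
      split_ifs with h
      · rw [h, yCoef_zero_left k hk, zero_smul, HahnSeries.coeff_zero]
      · simp
    simp [term, this]

theorem IsLow.C_mul {n : ℤ} {q : QuadPseudoDiff R δ} (hq : IsLow n q) (f : R) :
    IsLow n (C f * q) := fun i hi => by rw [coeff_C_mul, hq i hi, mul_zero]

theorem C_mul_monomial (f g : R) (i : ℤ) :
    (C f * monomial g i : QuadPseudoDiff R δ) = monomial (f * g) i := by
  refine coeff_injective (funext fun n => ?_)
  rw [coeff_C_mul, coeff_monomial, coeff_monomial, mul_ite, mul_zero]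

theorem monomial_mul_monomial_one (f : R) (i j : ℤ) :
    (monomial f i * monomial 1 j : QuadPseudoDiff R δ) = monomial f (i + j) := by
  refine coeff_injective (funext fun n => ?_)
  rw [monomial_mul_monomial_coeff, finsum_eq_single _ 0, coeff_monomial]
  · simp [yCoef_zero]
  · intro k hk
    obtain ⟨k, rfl⟩ := Nat.exists_eq_succ_of_ne_zero hk
    simp [pow_succ]

/-- The unit `y`. -/
noncomputable def y : (QuadPseudoDiff R δ)ˣ where
  val := monomial 1 1
  inv := monomial 1 (-1)
  val_inv := monomial_mul_monomial_one 1 1 (-1)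
  inv_val := monomial_mul_monomial_one 1 (-1) 1

theorem coe_y_zpow (n : ℤ) :
    ((y ^ n : (QuadPseudoDiff R δ)ˣ) : QuadPseudoDiff R δ) = monomial 1 n := by
  induction n with
  | zero => rfl
  | succ n ih =>
    rw [zpow_add_one, Units.val_mul, ih]
    exact monomial_mul_monomial_one 1 _ 1
  | pred n ih =>
    rw [zpow_sub_one, Units.val_mul, ih]
    exact monomial_mul_monomial_one 1 _ (-1)

theorem monomial_eq_C_mul (f : R) (n : ℤ) : (monomial f n : QuadPseudoDiff R δ) =
    C f * ((y ^ n : (QuadPseudoDiff R δ)ˣ) : QuadPseudoDiff R δ) := by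
  rw [coe_y_zpow, C_mul_monomial, mul_one]

theorem StartsWith.isLow {q : QuadPseudoDiff R δ} {f : R} {m : ℤ} (h : StartsWith q f m) :
    IsLow m q := h.2

theorem StartsWith.mul {p q : QuadPseudoDiff R δ} {f g : R} {m n : ℤ} (hp : StartsWith p f m)
    (hq : StartsWith q g n) : StartsWith (p * q) (f * g) (m + n) :=
  ⟨by rw [coeff_mul_of_isLow hp.2 hq.2, hp.1, hq.1], IsLow.mul hp.2 hq.2⟩

theorem startsWith_monomial (f : R) (n : ℤ) :
    StartsWith (monomial f n : QuadPseudoDiff R δ) f n :=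
  ⟨by rw [coeff_monomial, if_pos rfl], isLow_monomial f n⟩

theorem startsWith_one : StartsWith (1 : QuadPseudoDiff R δ) 1 0 := startsWith_monomial 1 0

theorem startsWith_C (f : R) : StartsWith (C f : QuadPseudoDiff R δ) f 0 :=
  startsWith_monomial f 0

theorem StartsWith.pow {q : QuadPseudoDiff R δ} {f : R} {m : ℤ} (h : StartsWith q f m) (n : ℕ) :
    StartsWith (q ^ n) (f ^ n) (n * m) := by
  induction n with
  | zero => simpa using startsWith_one
  | succ n ih =>
    rw [pow_succ, pow_succ, Nat.cast_succ, add_one_mul]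
    exact ih.mul h

theorem StartsWith.isLow_sub {p q : QuadPseudoDiff R δ} {f : R} {m : ℤ} (hp : StartsWith p f m)
    (hq : StartsWith q f m) : IsLow (m + 1) (p - q) :=
  (IsLow.sub hp.2 hq.2).succ (by rw [coeff_sub, hp.1, hq.1, sub_self])

theorem startsWith_of_isLow_sub {p q : QuadPseudoDiff R δ} {f : R} {m : ℤ}
    (hq : StartsWith q f m) (h : IsLow (m + 1) (p - q)) : StartsWith p f m := by
  have hc : ∀ i < m + 1, p.coeff i = q.coeff i := fun i hi => by
    simpa [sub_eq_zero] using h i hi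
  exact ⟨(hc m (by omega)).trans hq.1, fun i hi => (hc i (by omega)).trans (hq.2 i hi)⟩

theorem StartsWith.eq_of_ne_zero {q : QuadPseudoDiff R δ} {f g : R} {m n : ℤ}
    (h : StartsWith q f m) (h' : StartsWith q g n) (hf : f ≠ 0) (hg : g ≠ 0) :
    m = n ∧ f = g := by
  rcases lt_trichotomy m n with hlt | rfl | hlt
  · exact absurd (h.1.symm.trans (h'.2 m hlt)) hf
  · exact ⟨rfl, h.1.symm.trans h'.1⟩
  · exact absurd (h'.1.symm.trans (h.2 n hlt)) hg

theorem exists_startsWith {q : QuadPseudoDiff R δ} (hq : q ≠ 0) :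
    ∃ f m, f ≠ 0 ∧ StartsWith q f m :=
  have h : q.toSeries ≠ 0 := fun h => hq (toSeries_injective h)
  ⟨_, q.toSeries.order, HahnSeries.coeff_order_eq_zero.not.mpr h, rfl,
    fun _ hi => HahnSeries.coeff_eq_zero_of_lt_order hi⟩

/-- Completeness for the order filtration: each coefficient is eventually constant along the
sequence. -/
theorem exists_limit (m : ℤ) (x : ℕ → QuadPseudoDiff R δ)
    (hx : ∀ n : ℕ, IsLow (m + n) (x (n + 1) - x n)) :
    ∃ q, ∀ n : ℕ, IsLow (m + n) (q - x n) := by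
  have hle : ∀ n k : ℕ, IsLow (m + n) (x (n + k) - x n) := by
    intro n k
    induction k with
    | zero => simpa using isLow_zero _
    | succ k ih =>
      have := ((hx (n + k)).mono (m := m + n) (by push_cast; omega)).add ih
      rwa [sub_add_sub_cancel] at this
  obtain ⟨A, hA⟩ := exists_isLow (x 0)
  have hcoeff : ∀ i : ℤ, ∀ n : ℕ, i < m + n →
      (x (i - m + 1).toNat).coeff i = (x n).coeff i := by
    intro i n hn
    obtain ⟨k, hk⟩ | ⟨k, hk⟩ : (∃ k, n = (i - m + 1).toNat + k) ∨ ∃ k, (i - m + 1).toNat = n + k := by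
      rcases le_total (i - m + 1).toNat n with h | h
      · exact .inl ⟨_, (Nat.add_sub_cancel' h).symm⟩
      · exact .inr ⟨_, (Nat.add_sub_cancel' h).symm⟩
    · have := hle (i - m + 1).toNat k i (by omega)
      rw [coeff_sub, ← hk, sub_eq_zero] at this
      exact this.symm
    · have := hle n k i hn
      rw [coeff_sub, ← hk, sub_eq_zero] at this
      exact this
  -- `(i - m + 1).toNat` is the first stage from which the coefficient of index `i` no longer
  -- changes.
  refine ⟨⟨HahnSeries.ofSuppBddBelow (fun i => (x (i - m + 1).toNat).coeff i)
    ⟨min A m, fun i hi => ?_⟩⟩, fun n i hi => ?_⟩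
  · by_contra hlt
    rw [not_le, lt_min_iff] at hlt
    exact hi ((hcoeff i 0 (by simpa using hlt.2)).trans (hA i hlt.1))
  · rw [coeff_sub, sub_eq_zero]
    exact hcoeff i n hi

/-- Successive approximation. -/
theorem exists_root_of_step {R' : Type*} [CommRing R'] [Algebra ℚ R'] {δ' : Derivation ℤ R' R'}
    (F : QuadPseudoDiff R' δ' → QuadPseudoDiff R δ) (m d : ℤ) (x₀ : QuadPseudoDiff R' δ')
    (h₀ : IsLow d (F x₀))
    (hcont : ∀ x x' (n : ℕ), IsLow m (x - x₀) → IsLow m (x' - x₀) → IsLow (m + n) (x - x') →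
      IsLow (d + n) (F x - F x'))
    (hstep : ∀ x (n : ℕ), IsLow m (x - x₀) → IsLow (d + n) (F x) →
      ∃ c, IsLow (m + n) c ∧ IsLow (d + n + 1) (F (x + c))) :
    ∃ x, IsLow m (x - x₀) ∧ F x = 0 := by
  choose! c hc using hstep
  let X : ℕ → QuadPseudoDiff R' δ' := fun n => Nat.rec x₀ (fun n x => x + c x n) n
  have hX : ∀ n : ℕ, IsLow m (X n - x₀) ∧ IsLow (d + n) (F (X n)) := by
    intro n
    induction n with
    | zero => exact ⟨by simpa [X] using isLow_zero m, by simpa [X] using h₀⟩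
    | succ n ih =>
      have := hc (X n) n ih.1 ih.2
      refine ⟨?_, by rw [Nat.cast_succ, ← add_assoc]; exact this.2⟩
      have h2 := ih.1.add (this.1.mono (by omega))
      rwa [sub_add_eq_add_sub] at h2
  obtain ⟨x, hx⟩ := exists_limit m X fun n => by
    have := (hc (X n) n (hX n).1 (hX n).2).1
    rwa [show X (n + 1) - X n = c (X n) n from add_sub_cancel_left _ _]
  have hx₀ : IsLow m (x - x₀) := by simpa [X] using hx 0
  refine ⟨x, hx₀, eq_zero_of_isLow_nat d fun n => ?_⟩
  -- `F x` differs from `F (X n)` only from order `d + n` on, and `F (X n)` vanishes below that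
  -- order.
  have := (hcont x (X n) n hx₀ (hX n).1 (hx n)).add (hX n).2
  rwa [sub_add_cancel] at this

/-- The error `q * x - 1` is cancelled one coefficient at a time, dividing by `f`. The unit leading
coefficient of `p` is recorded so that the lemma applies to `p` in turn, which makes the inverse
two-sided. -/
theorem exists_right_inv {q : QuadPseudoDiff R δ} {f : R} {m : ℤ} (hq : StartsWith q f m)
    (hf : IsUnit f) : ∃ p, q * p = 1 ∧ ∃ g, IsUnit g ∧ StartsWith p g (-m) := by
  obtain ⟨u, rfl⟩ := hf
  obtain ⟨p, hp, hqp⟩ := exists_root_of_step (fun x => q * x - 1) (-m) 0 0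
    (by simpa using isLow_one.neg)
    (fun x x' n _ _ h => by
      rw [sub_sub_sub_cancel_right, ← mul_sub]
      exact (IsLow.mul hq.2 h).mono (by omega))
    (fun x n _ h => by
      refine ⟨monomial (-(↑u⁻¹ * (q * x - 1).coeff (0 + n))) (-m + n), isLow_monomial _ _, ?_⟩
      rw [mul_add, add_sub_right_comm]
      have h2 := hq.mul (startsWith_monomial (δ := δ)
        (-(↑u⁻¹ * (q * x - 1).coeff (0 + n))) (-m + n))
      rw [show m + (-m + (n : ℤ)) = 0 + n by ring] at h2
      refine (h.add h2.2).succ ?_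
      rw [coeff_add, h2.1]
      simp)
  rw [sub_zero] at hp
  rw [sub_eq_zero] at hqp
  have h1 := coeff_mul_of_isLow hq.isLow hp
  rw [hqp, coeff_one, if_pos (by omega), hq.1] at h1
  exact ⟨p, hqp, p.coeff (-m), .of_mul_eq_one (u : R) (by rw [mul_comm, ← h1]), rfl, hp⟩

theorem StartsWith.isUnit {q : QuadPseudoDiff R δ} {f : R} {m : ℤ} (hq : StartsWith q f m)
    (hf : IsUnit f) : IsUnit q := by
  obtain ⟨p, hp, g, hg, hpg⟩ := exists_right_inv hq hf
  obtain ⟨r, hr, -⟩ := exists_right_inv hpg hg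
  exact ⟨⟨q, p, hp, by rwa [left_inv_eq_right_inv hp hr]⟩, rfl⟩

/-- Square roots with a prescribed leading term. -/
theorem exists_sq_eq {u : QuadPseudoDiff R δ} {f : R} (hf : IsUnit f) {m : ℤ}
    (hu : StartsWith u (f ^ 2) (2 * m)) : ∃ v, StartsWith v f m ∧ v ^ 2 = u := by
  obtain ⟨t, ht⟩ : IsUnit (2 * f) := by
    refine IsUnit.mul ?_ hf
    simpa only [map_ofNat] using (IsUnit.mk0 (2 : ℚ) two_ne_zero).map (algebraMap ℚ R)
  have hs := startsWith_monomial (δ := δ) f m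
  obtain ⟨v, hv, h⟩ := exists_root_of_step (fun x => x ^ 2 - u) (m + 1) (2 * m + 1)
    (monomial f m) (by simpa using (hs.pow 2).isLow_sub hu)
    (fun x x' n hx hx' h => by
      have : x ^ 2 - u - (x' ^ 2 - u) = x * (x - x') + (x - x') * x' := by noncomm_ring
      rw [this]
      exact ((IsLow.mul (startsWith_of_isLow_sub hs hx).2 h).mono (by omega)).add
        ((IsLow.mul h (startsWith_of_isLow_sub hs hx').2).mono (by omega)))
    (fun x n hx h => by
      -- Adding a term `c` with coefficient `g` changes the square by `xc + cx + c²`. The first two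
      -- contribute `2fg = tg` at the order of the error, and `c²` starts later; `g` is chosen to
      -- cancel the error there.
      set g : R := -(↑t⁻¹ * (x ^ 2 - u).coeff (2 * m + 1 + n)) with hg
      have hc := startsWith_monomial (δ := δ) g (m + 1 + n)
      have hx' := startsWith_of_isLow_sub hs hx
      refine ⟨monomial g (m + 1 + n), hc.2, ?_⟩
      have : (x + monomial g (m + 1 + n)) ^ 2 - u = (x ^ 2 - u) +
          (x * monomial g (m + 1 + n) + monomial g (m + 1 + n) * x)
          + monomial g (m + 1 + n) * monomial g (m + 1 + n) := by noncomm_ring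
      rw [this]
      have h1 := hx'.mul hc
      have h2 := hc.mul hx'
      rw [show m + (m + 1 + (n : ℤ)) = 2 * m + 1 + n by ring] at h1
      rw [show m + 1 + (n : ℤ) + m = 2 * m + 1 + n by ring] at h2
      refine IsLow.add ?_ ((IsLow.mul hc.2 hc.2).mono (by omega))
      refine (h.add (IsLow.add h1.2 h2.2)).succ ?_
      rw [coeff_add, coeff_add, h1.1, h2.1]
      have : f * g + g * f = t * g := by rw [ht]; ring
      rw [this, hg, mul_neg, Units.mul_inv_cancel_left, add_neg_cancel])
  exact ⟨v, startsWith_of_isLow_sub hs hv, sub_eq_zero.mp h⟩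

end Basic

/-! ### Coefficients in a domain: units, uniqueness of roots, divisibility of orders. -/

section Domain

variable {R : Type*} [CommRing R] [IsDomain R] [Algebra ℚ R] {δ : Derivation ℤ R R}

instance : Nontrivial (QuadPseudoDiff R δ) := (C_injective (δ := δ)).nontrivial

instance : NoZeroDivisors (QuadPseudoDiff R δ) where
  eq_zero_or_eq_zero_of_mul_eq_zero {p q} h := by
    by_contra! hne
    obtain ⟨f, m, hf, hp⟩ := exists_startsWith hne.1
    obtain ⟨g, n, hg, hq⟩ := exists_startsWith hne.2
    have := (hp.mul hq).1
    rw [h, coeff_zero] at this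
    exact mul_ne_zero hf hg this.symm

theorem StartsWith.ne_zero {q : QuadPseudoDiff R δ} {f : R} {m : ℤ} (h : StartsWith q f m)
    (hf : f ≠ 0) : q ≠ 0 := by
  rintro rfl
  exact hf h.1.symm

/-- The leading coefficients of a unit and of its inverse multiply to the leading coefficient of 1,
as there are no zero divisors. -/
theorem exists_startsWith_of_isUnit {q : QuadPseudoDiff R δ} (hq : IsUnit q) :
    ∃ (f : Rˣ) (m : ℤ), StartsWith q f m := by
  obtain ⟨u, rfl⟩ := hq
  obtain ⟨f, m, hf, hu⟩ := exists_startsWith u.ne_zero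
  obtain ⟨g, n, hg, hv⟩ := exists_startsWith u⁻¹.ne_zero
  have h := hu.mul hv
  rw [u.mul_inv] at h
  have := (h.eq_of_ne_zero startsWith_one (mul_ne_zero hf hg) one_ne_zero).2
  exact ⟨⟨f, g, this, by rw [mul_comm, this]⟩, m, hu⟩

theorem StartsWith.inv {u : (QuadPseudoDiff R δ)ˣ} {f : Rˣ} {m : ℤ}
    (h : StartsWith (u : QuadPseudoDiff R δ) f m) :
    StartsWith (↑u⁻¹ : QuadPseudoDiff R δ) ↑f⁻¹ (-m) := by
  obtain ⟨g, n, hv⟩ := exists_startsWith_of_isUnit u⁻¹.isUnit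
  have h' := h.mul hv
  rw [u.mul_inv] at h'
  obtain ⟨h1, h2⟩ := h'.eq_of_ne_zero startsWith_one (f * g).ne_zero one_ne_zero
  have h3 : g = f⁻¹ := eq_inv_of_mul_eq_one_right (Units.ext h2)
  rwa [h3, show n = -m by omega] at hv

theorem StartsWith.zpow {u : (QuadPseudoDiff R δ)ˣ} {f : Rˣ} {m : ℤ}
    (h : StartsWith (u : QuadPseudoDiff R δ) f m) (n : ℤ) :
    StartsWith (↑(u ^ n) : QuadPseudoDiff R δ) ↑(f ^ n) (n * m) := by
  induction n with
  | zero => simpa using startsWith_one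
  | succ n ih =>
    rw [zpow_add_one, zpow_add_one, Units.val_mul, Units.val_mul, add_one_mul]
    exact ih.mul h
  | pred n ih =>
    rw [zpow_sub_one, zpow_sub_one, Units.val_mul, Units.val_mul, sub_one_mul, sub_eq_add_neg]
    exact ih.mul h.inv

/-- A square root is determined by its leading term. -/
theorem eq_of_sq_eq_sq {p q : QuadPseudoDiff R δ} {f : R} {m : ℤ} (hf : f ≠ 0)
    (hp : StartsWith p f m) (hq : StartsWith q f m) (h : p ^ 2 = q ^ 2) : p = q := by
  have : CharZero R := algebraRat.charZero R
  by_contra hne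
  obtain ⟨g, n, hg, hs⟩ := exists_startsWith (sub_ne_zero.mpr hne)
  have h1 := hp.mul hs
  have h2 := hs.mul hq
  rw [add_comm n m] at h2
  have h0 : p * (p - q) + (p - q) * q = 0 := by
    have : p * (p - q) + (p - q) * q = p ^ 2 - q ^ 2 := by noncomm_ring
    rw [this, h, sub_self]
  have h3 := congrArg (fun r => r.coeff (m + n)) h0
  simp only [coeff_add, coeff_zero, h1.1, h2.1] at h3
  have h4 : 2 * (f * g) = 0 := by rw [← h3]; ring
  exact mul_ne_zero two_ne_zero (mul_ne_zero hf hg) h4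

theorem exists_pow_two_pow_eq (k : ℕ) (q : QuadPseudoDiff R δ) (hq : StartsWith q 1 0) :
    ∃ p, p ^ 2 ^ k = q := by
  induction k generalizing q with
  | zero => exact ⟨q, by simp⟩
  | succ k ih =>
    obtain ⟨r, hr, hrq⟩ := exists_sq_eq (f := 1) isUnit_one (m := 0) (by simpa using hq)
    obtain ⟨p, hp⟩ := ih r hr
    exact ⟨p, by rw [pow_succ, _root_.pow_mul, hp, hrq]⟩

/-- The order of a `2^k`-th power is divisible by `2^k`; taking `k = |m|` suffices because `2^|m| >
|m|`. This turns the order condition into an algebraic one that automorphisms preserve. -/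
theorem order_eq_zero_of_pow {q : QuadPseudoDiff R δ} {f : R} {m : ℤ} (hf : f ≠ 0)
    (hq : StartsWith q f m) (h : ∀ k : ℕ, ∃ p, p ^ 2 ^ k = q) : m = 0 := by
  by_contra hm
  obtain ⟨p, hp⟩ := h m.natAbs
  have hp0 : p ≠ 0 := by
    rintro rfl
    rw [zero_pow (by positivity)] at hp
    exact hq.ne_zero hf hp.symm
  obtain ⟨g, n, hg, hpg⟩ := exists_startsWith hp0
  have h1 := ((hp ▸ hpg.pow _).eq_of_ne_zero hq (pow_ne_zero _ hg) hf).1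
  have h2 : (2 : ℤ) ^ m.natAbs ∣ m := ⟨n, by exact_mod_cast h1.symm⟩
  have h3 := Int.natAbs_dvd_natAbs.mpr h2
  rw [Int.natAbs_pow] at h3
  exact absurd (Nat.le_of_dvd (by omega) h3) (not_le.mpr Nat.lt_two_pow_self)

/-! ### Automorphisms stabilizing the coefficient ring respect orders. -/

/-- Ring automorphisms mapping `R` onto itself. -/
structure Stabilizes (θ : QuadPseudoDiff R δ ≃+* QuadPseudoDiff R δ) : Prop where
  map_C : ∀ f, ∃ g, θ (C f) = C g
  symm_C : ∀ f, ∃ g, θ.symm (C f) = C g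

namespace Stabilizes

variable {θ : QuadPseudoDiff R δ ≃+* QuadPseudoDiff R δ}

theorem symm (h : Stabilizes θ) : Stabilizes θ.symm := ⟨h.symm_C, h.map_C⟩

/-- If `θ q` had negative order, so would `θ (1 + q)`; but `1 + q` has all `2^k`-th roots, hence so
does its image, whose order must then be 0. -/
theorem isLow_zero_of_isLow_one {q : QuadPseudoDiff R δ} (hq : IsLow 1 q) : IsLow 0 (θ q) := by
  by_cases h0 : θ q = 0
  · rw [h0]; exact isLow_zero 0
  obtain ⟨f, m, hf, hm⟩ := exists_startsWith h0
  rcases le_or_gt 0 m with h | h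
  · exact hm.isLow.mono h
  refine absurd ?_ h.ne
  refine order_eq_zero_of_pow (q := θ (1 + q)) hf ?_ fun k => ?_
  · refine startsWith_of_isLow_sub hm ?_
    rw [map_add, map_one, add_sub_cancel_right]
    exact isLow_one.mono (by omega)
  · obtain ⟨p, hp⟩ := exists_pow_two_pow_eq k (1 + q)
      (startsWith_of_isLow_sub startsWith_one (by rwa [add_sub_cancel_left]))
    exact ⟨θ p, by rw [← map_pow, hp]⟩

theorem isLow_zero (hθ : Stabilizes θ) {q : QuadPseudoDiff R δ} (hq : IsLow 0 q) :
    IsLow 0 (θ q) := by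
  have h1 : IsLow 1 (q - C (q.coeff 0)) :=
    StartsWith.isLow_sub ⟨rfl, hq⟩ (startsWith_C (q.coeff 0))
  obtain ⟨g, hg⟩ := hθ.map_C (q.coeff 0)
  have h2 := (isLow_zero_of_isLow_one (θ := θ) h1).add (isLow_C g)
  rwa [← hg, ← map_add, sub_add_cancel] at h2

/-- Suppose `θ y` has constant term `a ≠ 0`; then `a` is a unit because `θ y` is one. With `θ b =
a⁻¹`, the series `1 - b y` has all `2^k`-th roots, yet its image has positive order, a
contradiction. -/
theorem isLow_one_y (hθ : Stabilizes θ) : IsLow 1 (θ y.val) := by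
  refine (hθ.isLow_zero ((isLow_monomial 1 1).mono zero_le_one)).succ ?_
  by_contra ha
  obtain ⟨a, m, hm⟩ := exists_startsWith_of_isUnit
    ((y (R := R) (δ := δ)).isUnit.map θ)
  have hm' : StartsWith (θ y.val) ((θ y.val).coeff 0) 0 :=
    ⟨rfl, hθ.isLow_zero ((isLow_monomial 1 1).mono zero_le_one)⟩
  obtain ⟨rfl, -⟩ := hm.eq_of_ne_zero hm' a.ne_zero ha
  obtain ⟨b, hb⟩ := hθ.symm_C ↑a⁻¹
  have hb' : θ (C b) = C ↑a⁻¹ := by rw [← hb, θ.apply_symm_apply]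
  have h1 : StartsWith (1 - C b * y.val : QuadPseudoDiff R δ) 1 0 := by
    refine startsWith_of_isLow_sub startsWith_one ?_
    rw [sub_sub_cancel_left]
    exact ((isLow_monomial 1 1).C_mul b).neg
  have h2 : IsLow 1 (θ (1 - C b * y.val)) := by
    rw [map_sub, map_one, map_mul, hb']
    refine StartsWith.isLow_sub startsWith_one ?_
    simpa using (startsWith_C (δ := δ) (↑a⁻¹ : R)).mul hm
  obtain ⟨f, m, hf, hfm⟩ := exists_startsWith
    ((map_ne_zero_iff θ θ.injective).mpr (h1.ne_zero one_ne_zero))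
  have h3 : m = 0 := order_eq_zero_of_pow hf hfm fun k => by
    obtain ⟨p, hp⟩ := exists_pow_two_pow_eq k _ h1
    exact ⟨θ p, by rw [← map_pow, hp]⟩
  subst h3
  exact hf (hfm.1.symm.trans (h2 0 one_pos))

theorem exists_startsWith_y (hθ : Stabilizes θ) : ∃ f : Rˣ, StartsWith (θ y.val) f 1 := by
  obtain ⟨f, m, hm⟩ := exists_startsWith_of_isUnit ((y (R := R) (δ := δ)).isUnit.map θ)
  have h1 : 1 ≤ m := by
    by_contra hlt
    exact f.ne_zero (hm.1.symm.trans (hθ.isLow_one_y m (by omega)))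
  rcases h1.eq_or_lt with rfl | h2
  · exact ⟨f, hm⟩
  exfalso
  -- If `θ y` had order at least 2, then `θ y * y⁻²` would have nonnegative order. Applying `θ⁻¹`
  -- writes `y` as a factor of order at least 0 times `(θ⁻¹ y)²`, so `y` would have order at least
  -- 2.
  have h3 : IsLow 0 (θ y.val * (y ^ (-2 : ℤ) : (QuadPseudoDiff R δ)ˣ).val) := by
    rw [coe_y_zpow]
    exact (IsLow.mul hm.isLow (isLow_monomial 1 (-2))).mono (by omega)
  have h4 : y.val =
      θ.symm (θ y.val * (y ^ (-2 : ℤ) : (QuadPseudoDiff R δ)ˣ).val) * (θ.symm y.val * θ.symm y.val) := by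
    rw [← map_mul, ← map_mul, ← Units.val_mul, mul_assoc, ← Units.val_mul]
    simp [zpow_neg, pow_two]
  have h5 := IsLow.mul (hθ.symm.isLow_zero h3) (IsLow.mul hθ.symm.isLow_one_y hθ.symm.isLow_one_y)
  rw [← h4] at h5
  exact one_ne_zero (((startsWith_monomial (δ := δ) (1 : R) 1).1).symm.trans (h5 1 (by norm_num)))

/-- Write `q = (q y^(-n)) yⁿ`: the first factor keeps nonnegative order, and the image of the second
has order exactly `n`. -/
theorem isLow (hθ : Stabilizes θ) {n : ℤ} {q : QuadPseudoDiff R δ} (hq : IsLow n q) :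
    IsLow n (θ q) := by
  obtain ⟨f, hf⟩ := hθ.exists_startsWith_y
  have h1 : IsLow 0 (q * (y ^ (-n) : (QuadPseudoDiff R δ)ˣ).val) := by
    rw [coe_y_zpow]
    exact (IsLow.mul hq (isLow_monomial 1 (-n))).mono (by omega)
  have h2 : StartsWith (θ (y ^ n : (QuadPseudoDiff R δ)ˣ)) ((f ^ n : Rˣ) : R) n := by
    have := StartsWith.zpow (u := Units.map (θ : QuadPseudoDiff R δ →* QuadPseudoDiff R δ) y) hf n
    rw [← map_zpow, mul_one] at this
    exact this
  have h3 := IsLow.mul (hθ.isLow_zero h1) h2.isLow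
  rw [← map_mul, mul_assoc, ← Units.val_mul, ← zpow_add, neg_add_cancel, zpow_zero,
    Units.val_one, mul_one, zero_add] at h3
  exact h3

theorem startsWith (hθ : Stabilizes θ) {n : ℤ} {q : QuadPseudoDiff R δ} {f g u : R}
    (hq : StartsWith q f n) (hf : θ (C f) = C g)
    (hu : StartsWith (θ (y ^ n : (QuadPseudoDiff R δ)ˣ)) u n) : StartsWith (θ q) (g * u) n := by
  have h1 : IsLow (n + 1) (q - C f * (y ^ n : (QuadPseudoDiff R δ)ˣ).val) := by
    rw [← monomial_eq_C_mul]
    exact hq.isLow_sub (startsWith_monomial f n)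
  have h2 := hθ.isLow h1
  rw [map_sub, map_mul, hf] at h2
  exact startsWith_of_isLow_sub (by simpa using (startsWith_C (δ := δ) g).mul hu) h2

end Stabilizes

end Domain

/-- For `i = -2` the factor `2(j-1) + i` vanishes at `j = 2`, so the expansion stops after one
derivative. This finite relation is what `w` can reproduce. -/
theorem monomial_neg_two_mul_C {R : Type*} [CommRing R] [Algebra ℚ R] {δ : Derivation ℤ R R}
    (f : R) : (monomial 1 (-2) * C f : QuadPseudoDiff R δ) =
      C f * monomial 1 (-2) - C (2 * δ f) := by
  have h1 : yCoef (-2) 1 = -2 := by norm_num [yCoef]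
  have h2 : ∀ k, 2 ≤ k → yCoef (-2) k = 0 := fun k hk =>
    Finset.prod_eq_zero (i := 1) (Finset.mem_range.mpr (by omega)) (by norm_num)
  refine coeff_injective (funext fun n => ?_)
  refine (monomial_mul_monomial_coeff (δ := δ) 1 f (-2) 0 n).trans ?_
  rw [finsum_eq_sum_of_support_subset (s := Finset.range 2)]
  · rw [coeff_sub, coeff_C_mul, coeff_monomial, coeff_C]
    simp only [Finset.sum_range_succ, Finset.sum_range_zero, h1, yCoef_zero, pow_zero, pow_one]
    by_cases h : n = -2
    · subst h; simp
    · by_cases h' : n = 0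
      · subst h'
        simp [Algebra.smul_def, map_ofNat (algebraMap ℚ R) 2]
      · simp [h, h']
  · intro k hk
    by_contra hlt
    simp only [Finset.coe_range, Set.mem_Iio, not_lt] at hlt
    exact hk (by simp [h2 k hlt])

/-- An additive map raising orders by at least a constant is determined by its values on
monomials. -/
theorem addMonoidHom_eq_zero {R R' : Type*} [CommRing R] [Algebra ℚ R] {δ : Derivation ℤ R R}
    [CommRing R'] [Algebra ℚ R'] {δ' : Derivation ℤ R' R'}
    (H : QuadPseudoDiff R' δ' →+ QuadPseudoDiff R δ) (d : ℤ)
    (hH : ∀ n q, IsLow n q → IsLow (n + d) (H q)) (hm : ∀ f i, H (monomial f i) = 0)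
    (q : QuadPseudoDiff R' δ') : H q = 0 := by
  -- Removing the leading monomial leaves `H q` unchanged but raises the order of the argument, so
  -- the bound on `H q` improves indefinitely.
  have key : ∀ (N : ℕ) (n : ℤ) (q), IsLow n q → IsLow (n + d + N) (H q) := by
    intro N
    induction N with
    | zero => intro n q hq; simpa using hH n q hq
    | succ N ih =>
      intro n q hq
      have h := ih (n + 1) (q - monomial (q.coeff n) n)
        (StartsWith.isLow_sub ⟨rfl, hq⟩ (startsWith_monomial _ n))
      rw [map_sub, hm, sub_zero] at h
      exact h.mono (by push_cast; omega)
  obtain ⟨n, hn⟩ := exists_isLow q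
  exact eq_zero_of_isLow_nat (n + d) fun N => key N n q hn

/-! ### Substituting a series of order one for the variable. -/

section Subst

variable {R R' : Type*} [CommRing R] [IsDomain R] [Algebra ℚ R] {δ : Derivation ℤ R R}
  [CommRing R'] [Algebra ℚ R'] {Δ : Derivation ℤ R' R'} (ι : R' →+* R)
  {v : (QuadPseudoDiff R δ)ˣ} {u : Rˣ}

/-- Since `v^i` has order `i`, only exponents `A ≤ i ≤ n` contribute to the coefficient of index
`n`. The free upper bound `B` lets different sums share one range. -/
theorem finsum_subst (hv : StartsWith (v : QuadPseudoDiff R δ) u 1) {q : QuadPseudoDiff R' Δ}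
    {A B n : ℤ} (hq : IsLow A q) (hn : n ≤ B) :
    ∑ᶠ i, ι (q.coeff i) * (v ^ i).val.coeff n =
      ∑ i ∈ Finset.Icc A B, ι (q.coeff i) * (v ^ i).val.coeff n := by
  refine finsum_eq_sum_of_support_subset _ fun i hi => ?_
  rw [Finset.coe_Icc, Set.mem_Icc]
  by_contra h
  rw [not_and_or, not_le, not_le] at h
  refine hi ?_
  rcases h with h | h
  · simp [hq i h]
  · simp only [(hv.zpow i).2 n (by omega), mul_zero]

/-- The substitution `∑ f_i y^i ↦ ∑ ι(f_i) v^i` as an additive map. -/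
noncomputable def substAdd (hv : StartsWith (v : QuadPseudoDiff R δ) u 1) :
    QuadPseudoDiff R' Δ →+ QuadPseudoDiff R δ :=
  AddMonoidHom.mk' (fun q => ⟨HahnSeries.ofSuppBddBelow
    (fun n => ∑ᶠ i, ι (q.coeff i) * (v ^ i).val.coeff n) (by
      obtain ⟨A, hA⟩ := exists_isLow q
      refine ⟨A, fun n hn => ?_⟩
      by_contra h
      refine hn ((finsum_subst ι hv hA le_rfl).trans ?_)
      rw [Finset.Icc_eq_empty h, Finset.sum_empty])⟩)
    (by
      intro p q
      refine coeff_injective (funext fun n => ?_)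
      obtain ⟨A, hA⟩ := exists_isLow p
      obtain ⟨B, hB⟩ := exists_isLow q
      have hA' := hA.mono (min_le_left A B)
      have hB' := hB.mono (min_le_right A B)
      refine (finsum_subst ι hv (hA'.add hB') le_rfl).trans (Eq.trans ?_ (congrArg₂ (· + ·)
        (finsum_subst ι hv hA' le_rfl) (finsum_subst ι hv hB' le_rfl)).symm)
      rw [← Finset.sum_add_distrib]
      exact Finset.sum_congr rfl fun i _ => by rw [coeff_add, map_add, add_mul])

theorem substAdd_coeff (hv : StartsWith (v : QuadPseudoDiff R δ) u 1) {q : QuadPseudoDiff R' Δ}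
    {A B n : ℤ} (hq : IsLow A q) (hn : n ≤ B) :
    (substAdd ι hv q).coeff n = ∑ i ∈ Finset.Icc A B, ι (q.coeff i) * (v ^ i).val.coeff n :=
  finsum_subst ι hv hq hn

theorem isSeriesIn_substAdd (hv : StartsWith (v : QuadPseudoDiff R δ) u 1)
    (q : QuadPseudoDiff R' Δ) : IsSeriesIn v (fun i => ι (q.coeff i)) (substAdd ι hv q) := by
  intro n
  obtain ⟨A, hA⟩ := exists_isLow q
  filter_upwards [Filter.eventually_ge_atTop (max (-A).toNat n.toNat)] with M hM j hj
  rw [substAdd_coeff ι hv (hA.mono (m := -(M : ℤ)) (by omega)) (B := M) (by omega), coeff_sum]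
  simp only [coeff_C_mul]

theorem isLow_substAdd (hv : StartsWith (v : QuadPseudoDiff R δ) u 1) {n : ℤ}
    {q : QuadPseudoDiff R' Δ} (hq : IsLow n q) : IsLow n (substAdd ι hv q) := fun i hi => by
  rw [substAdd_coeff ι hv hq le_rfl, Finset.Icc_eq_empty (by omega), Finset.sum_empty]

theorem substAdd_monomial (hv : StartsWith (v : QuadPseudoDiff R δ) u 1) (f : R') (i : ℤ) :
    substAdd ι hv (monomial f i : QuadPseudoDiff R' Δ) = C (ι f) * (v ^ i).val := by
  refine coeff_injective (funext fun n => ?_)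
  rw [coeff_C_mul]
  refine (finsum_eq_single _ i fun j hj => ?_).trans ?_
  · rw [coeff_monomial, if_neg hj, map_zero, zero_mul]
  · rw [coeff_monomial, if_pos rfl]

theorem startsWith_substAdd (hv : StartsWith (v : QuadPseudoDiff R δ) u 1)
    {q : QuadPseudoDiff R' Δ} {f : R'} {m : ℤ} (hq : StartsWith q f m) :
    StartsWith (substAdd ι hv q) (ι f * ↑(u ^ m)) m := by
  have h := isLow_substAdd ι hv (hq.isLow_sub (startsWith_monomial f m))
  rw [map_sub, substAdd_monomial] at h
  exact startsWith_of_isLow_sub (by simpa using (startsWith_C (δ := δ) (ι f)).mul (hv.zpow m)) h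

theorem substAdd_C_mul (hv : StartsWith (v : QuadPseudoDiff R δ) u 1) (f : R')
    (q : QuadPseudoDiff R' Δ) : substAdd ι hv (C f * q) = C (ι f) * substAdd ι hv q := by
  rw [← sub_eq_zero]
  refine addMonoidHom_eq_zero ((substAdd ι hv).comp (AddMonoidHom.mulLeft (C f)) -
    (AddMonoidHom.mulLeft (C (ι f))).comp (substAdd ι hv)) 0 (fun n q hq => ?_)
    (fun g i => ?_) q
  · rw [add_zero]
    exact (isLow_substAdd ι hv (hq.C_mul f)).sub ((isLow_substAdd ι hv hq).C_mul _)
  · change substAdd ι hv (C f * monomial g i) - C (ι f) * substAdd ι hv (monomial g i) = 0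
    rw [C_mul_monomial, substAdd_monomial, substAdd_monomial, map_mul, map_mul, mul_assoc, sub_self]

theorem substAdd_mul_y (hv : StartsWith (v : QuadPseudoDiff R δ) u 1)
    (q : QuadPseudoDiff R' Δ) : substAdd ι hv (q * y.val) = substAdd ι hv q * v.val := by
  rw [← sub_eq_zero]
  refine addMonoidHom_eq_zero ((substAdd ι hv).comp (AddMonoidHom.mulRight y.val) -
    (AddMonoidHom.mulRight v.val).comp (substAdd ι hv)) 1 (fun n q hq => ?_)
    (fun g i => ?_) q
  · exact (isLow_substAdd ι hv (IsLow.mul hq (isLow_monomial 1 1))).sub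
      (IsLow.mul (isLow_substAdd ι hv hq) hv.isLow)
  · change substAdd ι hv (monomial g i * monomial 1 1) - substAdd ι hv (monomial g i) * v.val = 0
    rw [monomial_mul_monomial_one, substAdd_monomial, substAdd_monomial, zpow_add_one,
      Units.val_mul, mul_assoc, sub_self]

theorem substAdd_y_neg_two_mul (hv : StartsWith (v : QuadPseudoDiff R δ) u 1)
    (hcomm : ∀ f : R', (v ^ (-2 : ℤ)).val * C (ι f) =
      C (ι f) * (v ^ (-2 : ℤ)).val - C (2 * ι (Δ f)))
    (q : QuadPseudoDiff R' Δ) :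
    substAdd ι hv (monomial 1 (-2) * q) = (v ^ (-2 : ℤ)).val * substAdd ι hv q := by
  rw [← sub_eq_zero]
  refine addMonoidHom_eq_zero ((substAdd ι hv).comp (AddMonoidHom.mulLeft (monomial 1 (-2))) -
    (AddMonoidHom.mulLeft (v ^ (-2 : ℤ)).val).comp (substAdd ι hv)) (-2) (fun n q hq => ?_)
    (fun g i => ?_) q
  · rw [add_comm]
    exact (isLow_substAdd ι hv (IsLow.mul (isLow_monomial 1 (-2)) hq)).sub
      (IsLow.mul ((hv.zpow (-2)).isLow.mono (by norm_num)) (isLow_substAdd ι hv hq))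
  · change substAdd ι hv (monomial 1 (-2) * monomial g i) -
      (v ^ (-2 : ℤ)).val * substAdd ι hv (monomial g i) = 0
    rw [monomial_eq_C_mul g i, ← mul_assoc, monomial_neg_two_mul_C, sub_mul, C_mul_monomial,
      coe_y_zpow, monomial_mul_monomial_one, C_mul_monomial, C_mul_monomial, map_sub,
      substAdd_monomial, substAdd_monomial, substAdd_monomial, ← mul_assoc, hcomm, sub_mul,
      mul_one, mul_assoc (C (ι g)), ← Units.val_mul, ← zpow_add]
    simp [map_ofNat ι 2]

/-- Let `D q` be the defect `φ(yq) - vφ(q)`. Compatibility with `y²` gives `D(yq) = -v D(q)`, while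
right multiplication gives `D(qy) = D(q) v`. Hence `D(qy - yq) = D(q) v + v D(q)`, where leading
coefficients add up instead of cancelling. Since `qy - yq` has larger order than expected, the
leading coefficient of `D q` must vanish, and repeating this kills `D`. -/
theorem substAdd_y_mul (hv : StartsWith (v : QuadPseudoDiff R δ) u 1)
    (hcomm : ∀ f : R', (v ^ (-2 : ℤ)).val * C (ι f) =
      C (ι f) * (v ^ (-2 : ℤ)).val - C (2 * ι (Δ f)))
    (q : QuadPseudoDiff R' Δ) : substAdd ι hv (y.val * q) = v.val * substAdd ι hv q := by
  have : CharZero R := algebraRat.charZero R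
  set φ : QuadPseudoDiff R' Δ →+ QuadPseudoDiff R δ := substAdd ι hv with hφ
  set D := φ.comp (AddMonoidHom.mulLeft y.val) - (AddMonoidHom.mulLeft v.val).comp φ
  have hD : ∀ q, D q = φ (y.val * q) - v.val * φ q := fun _ => rfl
  have hsq : ∀ q, φ (y.val * (y.val * q)) = v.val * (v.val * φ q) := by
    intro q
    have h := substAdd_y_neg_two_mul ι hv hcomm (y.val * (y.val * q))
    rw [← coe_y_zpow, ← mul_assoc, ← mul_assoc, ← Units.val_mul, ← Units.val_mul,
      show (y ^ (-2 : ℤ) * y * y : (QuadPseudoDiff R' Δ)ˣ) = 1 by group, Units.val_one, one_mul,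
      ← hφ, ← Units.inv_mul_eq_iff_eq_mul, ← zpow_neg] at h
    rw [← h, ← mul_assoc, ← Units.val_mul, neg_neg, ← zpow_two]
  have h1 : ∀ q, v.val * D q + D (y.val * q) = 0 := fun q => by
    rw [hD, hD, hsq, mul_sub, ← mul_assoc]
    abel
  have h2 : ∀ q, D (q * y.val) = D q * v.val := fun q => by
    rw [hD, hD, ← mul_assoc, substAdd_mul_y, substAdd_mul_y, sub_mul, mul_assoc]
  have key : ∀ (N : ℕ) (n : ℤ) (q), IsLow n q → IsLow (n + 1 + N) (D q) := by
    intro N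
    induction N with
    | zero =>
      intro n q hq
      rw [Nat.cast_zero, add_zero, add_comm, hD]
      exact (isLow_substAdd ι hv (IsLow.mul (isLow_monomial 1 1) hq)).sub
        (IsLow.mul hv.isLow (isLow_substAdd ι hv hq))
    | succ N ih =>
      intro n q hq
      have hy := startsWith_monomial (δ := Δ) (1 : R') 1
      have hq' : StartsWith q (q.coeff n) n := ⟨rfl, hq⟩
      -- Both products have the same coefficient at `n + 1`, so the commutator gains one order.
      have h3 : IsLow (n + 1 + 1) (q * y.val - y.val * q) := by
        refine StartsWith.isLow_sub (f := q.coeff n) ?_ ?_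
        · simpa using StartsWith.mul (q := y.val) hq' hy
        · rw [add_comm]; simpa using StartsWith.mul (p := y.val) hy hq'
      have h4 := ih _ _ h3
      have h5 : D (q * y.val - y.val * q) = D q * v.val + v.val * D q := by
        rw [map_sub, h2, eq_neg_of_add_eq_zero_right (h1 q), sub_neg_eq_add]
      have h6 : StartsWith (D q) ((D q).coeff (n + 1 + N)) (n + 1 + N) := ⟨rfl, ih n q hq⟩
      rw [h5] at h4
      -- By induction the left side vanishes at this index, where the right side has `2u` times the
      -- coefficient of `D q` at `n + 1 + N`.
      have h7 := h4 (n + 1 + N + 1) (by omega)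
      have h8 := (hv.mul h6).1
      rw [add_comm (1 : ℤ)] at h8
      rw [coeff_add, (h6.mul hv).1, h8, mul_comm, ← two_mul] at h7
      have h9 := ((mul_eq_zero.mp h7).resolve_left two_ne_zero)
      rw [Nat.cast_succ, ← add_assoc]
      exact (ih n q hq).succ ((mul_eq_zero.mp h9).resolve_left u.ne_zero)
  obtain ⟨n, hn⟩ := exists_isLow q
  rw [← sub_eq_zero]
  exact eq_zero_of_isLow_nat (n + 1) fun N => key N n q hn

theorem substAdd_y_zpow_mul (hv : StartsWith (v : QuadPseudoDiff R δ) u 1)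
    (hcomm : ∀ f : R', (v ^ (-2 : ℤ)).val * C (ι f) =
      C (ι f) * (v ^ (-2 : ℤ)).val - C (2 * ι (Δ f))) (i : ℤ) (q : QuadPseudoDiff R' Δ) :
    substAdd ι hv ((y ^ i).val * q) = (v ^ i).val * substAdd ι hv q := by
  induction i generalizing q with
  | zero => simp
  | succ i ih =>
    rw [zpow_add_one, zpow_add_one, Units.val_mul, Units.val_mul, mul_assoc, mul_assoc, ih,
      substAdd_y_mul ι hv hcomm]
  | pred i ih =>
    rw [zpow_sub_one, zpow_sub_one, Units.val_mul, Units.val_mul, mul_assoc, mul_assoc, ih]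
    congr 1
    rw [Units.eq_inv_mul_iff_mul_eq, ← substAdd_y_mul ι hv hcomm, Units.mul_inv_cancel_left]

/-- The substitution `∑ f_i y^i ↦ ∑ ι(f_i) v^i` as a ring homomorphism. -/
noncomputable def subst (hv : StartsWith (v : QuadPseudoDiff R δ) u 1)
    (hcomm : ∀ f : R', (v ^ (-2 : ℤ)).val * C (ι f) =
      C (ι f) * (v ^ (-2 : ℤ)).val - C (2 * ι (Δ f))) :
    QuadPseudoDiff R' Δ →+* QuadPseudoDiff R δ :=
  { substAdd ι hv with
    map_one' := by
      refine (substAdd_monomial ι hv 1 0).trans ?_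
      simp
    map_mul' := fun p q => by
      change substAdd ι hv (p * q) = substAdd ι hv p * substAdd ι hv q
      -- With `q` fixed, both sides are additive in `p` and raise its order by at least `A`, so
      -- monomials `p` suffice.
      obtain ⟨A, hA⟩ := exists_isLow q
      rw [← sub_eq_zero]
      refine addMonoidHom_eq_zero ((substAdd ι hv).comp (AddMonoidHom.mulRight q) -
        (AddMonoidHom.mulRight (substAdd ι hv q)).comp (substAdd ι hv)) A (fun n p hp => ?_)
        (fun g i => ?_) p
      · exact (isLow_substAdd ι hv (IsLow.mul hp hA)).sub
          (IsLow.mul (isLow_substAdd ι hv hp) (isLow_substAdd ι hv hA))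
      · change substAdd ι hv (monomial g i * q) -
          substAdd ι hv (monomial g i) * substAdd ι hv q = 0
        rw [substAdd_monomial, monomial_eq_C_mul, mul_assoc, substAdd_C_mul,
          substAdd_y_zpow_mul ι hv hcomm, mul_assoc, sub_self] }

theorem substAdd_injective (hι : Function.Injective ι)
    (hv : StartsWith (v : QuadPseudoDiff R δ) u 1) :
    Function.Injective (substAdd ι hv : QuadPseudoDiff R' Δ →+ QuadPseudoDiff R δ) := by
  rw [injective_iff_map_eq_zero]
  intro q hq
  by_contra hne
  obtain ⟨f, m, hf, hm⟩ := exists_startsWith hne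
  have h := (startsWith_substAdd ι hv hm).1
  rw [hq, coeff_zero] at h
  exact mul_ne_zero ((map_ne_zero_iff ι hι).mpr hf) (u ^ m).ne_zero h.symm

/-- Successive approximation inside `S`. As `S` contains all powers of `v`, an error of any order
can be moved to order 0, so `hlead` is needed only there. -/
theorem exists_substAdd_eq (hv : StartsWith (v : QuadPseudoDiff R δ) u 1)
    (S : Subring (QuadPseudoDiff R δ)) (hS : ∀ p : QuadPseudoDiff R' Δ, substAdd ι hv p ∈ S)
    (hvS : ∀ i : ℤ, (v ^ i).val ∈ S) (hlead : ∀ q ∈ S, IsLow 0 q → ∃ f, ι f = q.coeff 0)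
    {q : QuadPseudoDiff R δ} (hq : q ∈ S) : ∃ p : QuadPseudoDiff R' Δ, substAdd ι hv p = q := by
  obtain ⟨n, hn⟩ := exists_isLow q
  obtain ⟨p, -, hp⟩ := exists_root_of_step (fun p : QuadPseudoDiff R' Δ => substAdd ι hv p - q)
    n n 0 (by simpa using hn.neg)
    (fun x x' k _ _ h => by
      rw [sub_sub_sub_cancel_right, ← map_sub]
      exact isLow_substAdd ι hv h)
    (fun x k _ h => by
      set r := substAdd ι hv x - q with hr
      have hrs : StartsWith r (r.coeff (n + k)) (n + k) := ⟨rfl, h⟩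
      -- Multiplying by `v^(-(n+k))` moves the leading coefficient of the error to degree 0, up to a
      -- power of `u` that the correction `-f v^(n+k)` restores.
      have h1 := hrs.mul (hv.zpow (-(n + k)))
      rw [mul_one, add_neg_cancel] at h1
      obtain ⟨f, hf⟩ := hlead _ (S.mul_mem (S.sub_mem (hS x) hq) (hvS (-(n + k)))) h1.isLow
      refine ⟨monomial (-f) (n + k), isLow_monomial _ _, ?_⟩
      have h2 := startsWith_substAdd ι hv (startsWith_monomial (δ := Δ) (-f) (n + k))
      rw [map_add, add_sub_right_comm]
      refine (h.add h2.isLow).succ ?_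
      rw [coeff_add, h2.1, map_neg, hf, h1.1, zpow_neg, neg_mul, Units.inv_mul_cancel_right,
        add_neg_cancel])
  exact ⟨p, sub_eq_zero.mp hp⟩

end Subst

/-! ### Invariants of the group action and the restricted derivation. -/

section Action

variable {R : Type*} [CommRing R] [IsDomain R] [Algebra ℚ R] {δ : Derivation ℤ R R}
  {Γ : Type*} [Group Γ] [MulSemiringAction Γᵐᵒᵖ (QuadPseudoDiff R δ)]

/-- The inverse automorphism is the action of `γ⁻¹`, so the hypothesis covers both directions. -/
theorem stabilizes_toRingEquiv
    (hstab : ∀ (γ : Γ) (f : R), ∃ g : R,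
      MulOpposite.op γ • (C f : QuadPseudoDiff R δ) = C g) (γ : Γ) :
    Stabilizes (MulSemiringAction.toRingEquiv Γᵐᵒᵖ (QuadPseudoDiff R δ) (MulOpposite.op γ)) :=
  ⟨hstab γ, hstab γ⁻¹⟩

theorem units_zpow_smul {G A : Type*} [Group G] [Ring A] [MulSemiringAction G A] {g : G} {v : Aˣ}
    (h : g • (v : A) = v) (i : ℤ) : g • ((v ^ i : Aˣ) : A) = (v ^ i : Aˣ) := by
  have h1 : Units.map (MulSemiringAction.toRingHom G A g : A →* A) v = v := Units.ext h
  have h2 := map_zpow (Units.map (MulSemiringAction.toRingHom G A g : A →* A)) v i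
  rw [h1] at h2
  exact congrArg Units.val h2

/-- Automorphisms respect orders, so the constant term of the image is the image of the constant
term. -/
theorem smul_C_of_startsWith
    (hstab : ∀ (γ : Γ) (f : R), ∃ g : R,
      MulOpposite.op γ • (C f : QuadPseudoDiff R δ) = C g) (γ : Γ) {q : QuadPseudoDiff R δ} {f : R}
    (hq : StartsWith q f 0) (hfix : MulOpposite.op γ • q = q) :
    MulOpposite.op γ • (C f : QuadPseudoDiff R δ) = C f := by
  obtain ⟨g, hg⟩ := hstab γ f
  have h := (stabilizes_toRingEquiv hstab γ).startsWith hq hg (u := 1)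
    (by simpa using startsWith_one)
  have h1 : (MulOpposite.op γ • q).coeff 0 = g * 1 := h.1
  rw [hfix, hq.1, mul_one] at h1
  rw [hg, h1]

theorem sq_monomial_add_C_mul_C (e h f : R) :
    ((monomial (e ^ 2) (-2) + C h) * C f : QuadPseudoDiff R δ) =
      C f * (monomial (e ^ 2) (-2) + C h) - C (2 * (e ^ 2 * δ f)) := by
  have h1 : (monomial (e ^ 2) (-2) : QuadPseudoDiff R δ) = C (e ^ 2) * monomial 1 (-2) := by
    rw [C_mul_monomial, mul_one]
  rw [h1, add_mul, mul_assoc, monomial_neg_two_mul_C, mul_sub, mul_add, ← mul_assoc, ← mul_assoc,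
    ← map_mul, ← map_mul, ← map_mul, ← map_mul, ← map_mul, mul_comm f, mul_comm f,
    mul_left_comm 2]
  abel

/-- Twice the element is a commutator of two invariants, `f` and `w`; the factor 2 is removed
because the invariants form a `ℚ`-subalgebra. -/
theorem sq_mul_derivation_mem_invariantCoeffs {e h : R}
    (hw : ∀ γ : Γ, MulOpposite.op γ • (monomial (e ^ 2) (-2) + C h : QuadPseudoDiff R δ) =
      monomial (e ^ 2) (-2) + C h) {f : R} (hf : f ∈ invariantCoeffs δ Γ) :
    e ^ 2 * δ f ∈ invariantCoeffs δ Γ := by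
  have h2 : 2 * (e ^ 2 * δ f) ∈ invariantCoeffs δ Γ := fun γ => by
    have h3 : (C (2 * (e ^ 2 * δ f)) : QuadPseudoDiff R δ) =
        C f * (monomial (e ^ 2) (-2) + C h) - (monomial (e ^ 2) (-2) + C h) * C f := by
      rw [sq_monomial_add_C_mul_C, sub_sub_cancel]
    rw [h3, smul_sub, smul_mul', smul_mul', hw γ, hf γ]
  have h4 := (invariantCoeffs δ Γ).smul_mem h2 (1 / 2 : ℚ)
  rwa [two_mul, ← two_smul ℚ (e ^ 2 * δ f), smul_smul, show (1 / 2 : ℚ) * 2 = 1 by norm_num,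
    one_smul] at h4

/-- The restriction of `a δ` to an invariant subring that it preserves. -/
noncomputable def restrictDerivation {A : Type*} [CommRing A] [Algebra ℚ A] (d : Derivation ℤ A A) (a : A)
    (S : Subalgebra ℚ A) (hS : ∀ f ∈ S, a * d f ∈ S) : Derivation ℤ S S :=
  Derivation.mk' (AddMonoidHom.toIntLinearMap
    (AddMonoidHom.mk' (fun f => (⟨a * d f, hS f f.2⟩ : S)) fun f g => Subtype.ext <| by
      simp [mul_add])) fun f g => Subtype.ext <| by
        change a * d (f * g) = f * (a * d g) + g * (a * d f)
        rw [Derivation.leibniz, smul_eq_mul, smul_eq_mul]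
        ring

end Action

end QuadPseudoDiff

/-! ### The cocycle, the invariant square root and the ring of invariants. -/

theorem mainTheorem5 {R : Type*} [CommRing R] [IsDomain R] [Algebra ℚ R] (δ : Derivation ℤ R R)
    {Γ : Type*} [Group Γ] [MulSemiringAction Γᵐᵒᵖ (QuadPseudoDiff R δ)]
    (hstab : ∀ (γ : Γ) (f : R), ∃ g : R,
      MulOpposite.op γ • (C f : QuadPseudoDiff R δ) = C g) :
    ∃ s : Γ → Rˣ,
      (∀ γ : Γ, StartsWith (MulOpposite.op γ • (monomial 1 1 : QuadPseudoDiff R δ))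
        ((s γ)⁻¹ : Rˣ) 1) ∧
      (∀ γ γ' : Γ, (C (s (γ * γ') : R) : QuadPseudoDiff R δ)
        = (MulOpposite.op γ' • C (s γ : R)) * C (s γ' : R)) ∧
      ∀ (e : Rˣ) (h : R) (w : QuadPseudoDiff R δ),
        w = monomial ((e : R) ^ 2) (-2) + C h →
        (∀ γ : Γ, MulOpposite.op γ • w = w) →
        (∀ γ : Γ, MulOpposite.op γ • (C (e : R) : QuadPseudoDiff R δ)
          = C (((s γ)⁻¹ : Rˣ) * (e : R))) →
        ∃ Δ : Derivation ℤ (invariantCoeffs δ Γ) (invariantCoeffs δ Γ),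
          (∀ f : invariantCoeffs δ Γ, (Δ f : R) = (e : R) ^ 2 * δ f) ∧
          ∃ W v : (QuadPseudoDiff R δ)ˣ, (W : QuadPseudoDiff R δ) = w ∧ v ^ 2 = W⁻¹ ∧
            StartsWith (v : QuadPseudoDiff R δ) ((e⁻¹ : Rˣ) : R) 1 ∧
            (∀ v' : QuadPseudoDiff R δ, v' ^ 2 = (W⁻¹ : (QuadPseudoDiff R δ)ˣ) →
              StartsWith v' ((e⁻¹ : Rˣ) : R) 1 → v' = v) ∧
            ∃ φ : QuadPseudoDiff (invariantCoeffs δ Γ) Δ →+* QuadPseudoDiff R δ,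
              (∀ q, IsSeriesIn v (fun i => (q.coeff i : R)) (φ q)) ∧
              Function.Injective φ ∧
              φ.range = FixedPoints.subring (QuadPseudoDiff R δ) Γᵐᵒᵖ := by
  have hθ := stabilizes_toRingEquiv hstab
  -- `t γ` is the leading coefficient of `y·γ`, that is `s_γ⁻¹`.
  choose t ht using fun γ => (hθ γ).exists_startsWith_y
  have hlead : ∀ (γ : Γ) {f g : R} {q : QuadPseudoDiff R δ}, StartsWith q f 1 →
      MulOpposite.op γ • (C f : QuadPseudoDiff R δ) = C g →
      StartsWith (MulOpposite.op γ • q) (g * t γ) 1 := fun γ f g q hq hg =>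
    (hθ γ).startsWith hq hg (by simpa using ht γ)
  have hCinv : ∀ (γ : Γ) {f f' g g' : R}, f * f' = 1 →
      MulOpposite.op γ • (C f : QuadPseudoDiff R δ) = C g →
      MulOpposite.op γ • (C f' : QuadPseudoDiff R δ) = C g' → g * g' = 1 := by
    intro γ f f' g g' hff hf hf'
    apply C_injective (δ := δ)
    rw [map_mul, ← hf, ← hf', ← smul_mul', ← map_mul, hff, map_one, smul_one]
  refine ⟨fun γ => (t γ)⁻¹, fun γ => by rw [inv_inv]; exact ht γ, fun γ γ' => ?_, ?_⟩
  · obtain ⟨g, hg⟩ := hstab γ' (t γ)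
    obtain ⟨k, hk⟩ := hstab γ' ↑(t γ)⁻¹
    -- Two computations of the leading coefficient of `y·γγ'`; inverting their equality gives the
    -- cocycle identity.
    have h1 := hlead γ' (ht γ) hg
    have h2 : StartsWith (MulOpposite.op γ' • MulOpposite.op γ •
        (monomial 1 1 : QuadPseudoDiff R δ)) (t (γ * γ')) 1 := by
      rw [smul_smul, ← MulOpposite.op_mul]
      exact ht (γ * γ')
    have h3 : (t (γ * γ') : R) = g * t γ' := h2.1.symm.trans h1.1
    have h4 := hCinv γ' (t γ).inv_mul hk hg
    rw [hk, ← map_mul]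
    congr 1
    refine Units.inv_eq_of_mul_eq_one_right ?_
    rw [h3, mul_comm k, mul_assoc, Units.mul_inv_cancel_left, mul_comm, h4]
  intro e h w hw hwfix he
  subst hw
  simp only [inv_inv] at he
  have hwlead : StartsWith (monomial ((e : R) ^ 2) (-2) + C h : QuadPseudoDiff R δ)
      ((e ^ 2 : Rˣ) : R) (-2) := by
    rw [Units.val_pow_eq_pow_val]
    refine startsWith_of_isLow_sub (startsWith_monomial _ _) ?_
    rw [add_sub_cancel_left]
    exact (isLow_C h).mono (by norm_num)
  obtain ⟨W, hW⟩ := hwlead.isUnit (e ^ 2).isUnit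
  have hWinv : StartsWith (W⁻¹).val ((e⁻¹ : Rˣ) ^ 2 : R) (2 * 1) := by
    have := StartsWith.inv (hW ▸ hwlead)
    rwa [← inv_pow, Units.val_pow_eq_pow_val] at this
  obtain ⟨v, hv, hvW⟩ := exists_sq_eq (e⁻¹).isUnit hWinv
  obtain ⟨v, rfl⟩ := hv.isUnit (e⁻¹).isUnit
  have hvW' : v ^ 2 = W⁻¹ := Units.ext hvW
  have huniq : ∀ v' : QuadPseudoDiff R δ, v' ^ 2 = (W⁻¹ : (QuadPseudoDiff R δ)ˣ) →
      StartsWith v' ((e⁻¹ : Rˣ) : R) 1 → v' = v := fun v' h1 h2 =>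
    eq_of_sq_eq_sq (e⁻¹).ne_zero h2 hv (h1.trans hvW.symm)
  have hv2 : v ^ (-2 : ℤ) = W := by
    rw [zpow_neg, ← inv_inj, inv_inv, ← hvW']
    rfl
  -- `v·γ` is a square root of the invariant `W⁻¹`. Its leading coefficient is `(e⁻¹·γ) t_γ`, which
  -- equals `e⁻¹` because `e·γ = t_γ e`.
  have hvfix : ∀ γ : Γ, MulOpposite.op γ • v.val = v.val := fun γ => by
    refine huniq _ ?_ ?_
    · rw [← smul_pow', hvW]
      simpa using units_zpow_smul (v := W) (by rw [hW]; exact hwfix γ) (-1)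
    · obtain ⟨k, hk⟩ := hstab γ ↑e⁻¹
      have h1 := hlead γ hv hk
      have h2 := hCinv γ e.inv_mul hk (he γ)
      rw [← mul_assoc] at h2
      rwa [Units.eq_inv_of_mul_eq_one_right h2] at h1
  refine ⟨restrictDerivation δ ((e : R) ^ 2) (invariantCoeffs δ Γ)
    fun f => sq_mul_derivation_mem_invariantCoeffs hwfix, fun f => rfl, W, v, hW, hvW', hv, huniq,
    ?_⟩
  set Δ := restrictDerivation δ ((e : R) ^ 2) (invariantCoeffs δ Γ)
    fun f => sq_mul_derivation_mem_invariantCoeffs hwfix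
  let ι : invariantCoeffs δ Γ →+* R := (invariantCoeffs δ Γ).val
  have hcomm : ∀ f : invariantCoeffs δ Γ, (v ^ (-2 : ℤ)).val * C (ι f) =
      C (ι f) * (v ^ (-2 : ℤ)).val - C (2 * ι (Δ f)) := fun f => by
    rw [hv2, hW]
    exact sq_monomial_add_C_mul_C (e : R) h f
  have hvpow : ∀ i : ℤ, (v ^ i).val ∈ FixedPoints.subring (QuadPseudoDiff R δ) Γᵐᵒᵖ :=
    fun i γ => units_zpow_smul (hvfix γ.unop) i
  have hmem : ∀ q : QuadPseudoDiff (invariantCoeffs δ Γ) Δ,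
      substAdd ι hv q ∈ FixedPoints.subring (QuadPseudoDiff R δ) Γᵐᵒᵖ := fun q γ => by
    -- Since the action respects orders, invariance of the substituted series need only be checked
    -- on monomials.
    rw [← sub_eq_zero]
    refine addMonoidHom_eq_zero
      ((DistribSMul.toAddMonoidHom (QuadPseudoDiff R δ) γ).comp (substAdd ι hv) - substAdd ι hv) 0
      (fun n q hq => ?_) (fun f i => ?_) q
    · rw [add_zero]
      exact IsLow.sub ((hθ γ.unop).isLow (isLow_substAdd ι hv hq)) (isLow_substAdd ι hv hq)
    · change γ • substAdd ι hv (monomial f i) - substAdd ι hv (monomial f i) = 0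
      rw [substAdd_monomial, smul_mul', hvpow i γ, sub_eq_zero]
      congr 1
      exact f.2 γ.unop
  refine ⟨subst ι hv hcomm, isSeriesIn_substAdd ι hv,
    substAdd_injective ι Subtype.val_injective hv, le_antisymm ?_ fun q hq => ?_⟩
  · rintro _ ⟨q, rfl⟩
    exact hmem q
  · exact exists_substAdd_eq ι hv _ hmem hvpow (fun q hq hlow =>
      ⟨⟨q.coeff 0, fun γ => smul_C_of_startsWith hstab γ ⟨rfl, hlow⟩ (hq (MulOpposite.op γ))⟩,
        rfl⟩) hq
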